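/- **Theorem (number of isotropy summands).** Let $U/K$ be one of the flag manifolds of a classical compact Lie group listed below, with Lie algebras $\mathfrak u\supset\mathfrak k$, and let $\mathfrak g=\mathfrak u^{\mathbb C}$, with Cartan subalgebra $\mathfrak h\subset\mathfrak k^{\mathbb C}$ the diagonal matrices. Let $\mathfrak m$ be the orthogonal complement of $\mathfrak k$ in $\mathfrak u$ with respect to the Killing form (the tangent space of $U/K$ at the origin). An *isotropy summand* is a term of a decomposition of $\mathfrak m$ into a direct sum of irreducible $\mathrm{ad}(\mathfrak k)$-submodules. Let $\Pi$ be the set of roots of $(\mathfrak g,\mathfrak h)$ and $\Pi^+$ the standard set of positive roots ($\varepsilon_p-\varepsilon_q$, $p<q$, in type $A$; these together with $\varepsilon_p+\varepsilon_q$, $p<q$, in types $B$, $C$, $D$; and in addition $\varepsilon_p$ in type $B$ and $2\varepsilon_p$ in type $C$). Let $\Pi_\Theta\subset\Pi$ be the set of roots of $(\mathfrak k^{\mathbb C},\mathfrak h)$, $\Pi_M^+=\Pi^+\setminus\Pi_\Theta$, and $\mathfrak t=Z(\mathfrak k^{\mathbb C})\cap i\mathfrak h_{\mathbb R}$, where $i\mathfrak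 h_{\mathbb R}=\mathfrak h\cap\mathfrak u$. The set of positive t-roots is $\Pi_{\mathfrak t}^+=\{\alpha|_{\mathfrak t}:\alpha\in\Pi_M^+\}$. Let $d_1,\dots,d_r\ge 1$ be integers, let $s$ be the number of indices $i$ with $d_i>1$ and $m$ the number of indices with $d_i=1$ (so $r=s+m$). Then $\mathfrak m$ is a direct sum of irreducible $\mathrm{ad}(\mathfrak k)$-submodules, and both the number of terms of any such decomposition and $|\Pi_{\mathfrak t}^+|$ are equal to the following number: - type $A$: $SU(n)/S(U(d_1)\times\cdots\times U(d_r))$, $n=\sum d_i$: $\ r(r-1)/2$; - type $B$ (i): $SO(2n+1)/U(d_1)\times\cdots\times U(d_r)$, $n=\sum d_i\ge 2$: $\ (s+m)^2+s$; - type $B$ (ii): $SO(2n+1)/U(d_1)\times\cdots\times U(d_r)\times SO(2t+1)$, $n=\sum d_i+t$, $t\ge 2$: $\ (s+m)^2+s$; - type $C$ (i): $Sp(n)/U(d_1)\times\cdots\times U(d_r)$, $n=\sum d_i\ge 3$: $\ (s+m)^2$; - type $C$ (ii): $Sp(n)/U(d_1)\times\cdots\times U(d_r)\times Sp(t)$,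 $n=\sum d_i+t$, $t\ge 3$: $\ (s+m)^2+(s+m)$; - type $D$ (i): $SO(2n)/U(d_1)\times\cdots\times U(d_r)$, $n=\sum d_i\ge 4$: $\ (s+m)^2-m$; - type $D$ (ii): $SO(2n)/U(d_1)\times\cdots\times U(d_r)\times SO(2t)$, $n=\sum d_i+t$, $t\ge 4$: $\ (s+m)^2+s$. The case $r=0$ is allowed wherever the stated bounds permit it. The subgroups are the standard block-diagonal ones. -/

import Mathlib

/-!
Isotropy summands and positive t-roots of flag manifolds of the classical compact groups.

All Lie algebras are concrete Lie algebras of complex matrices, chosen so that the diagonal matrices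
form a Cartan subalgebra and the skew-Hermitian matrices form a compact real form.
-/

noncomputable section

attribute [local instance 100] LieRing.ofAssociativeRing

namespace FlagManifold

/-! ### General constructions

`g` is a complex matrix Lie algebra, and `β : N → B` partitions the rows and columns into blocks. The
isotropy subalgebra consists of the matrices of `g` that are block diagonal for this partition. -/

section General

variable {N B : Type} [Fintype N] [DecidableEq N]

/-- The Cartan subalgebra `𝔥`: the diagonal matrices of `g`. -/
def cartan (g : LieSubalgebra ℂ (Matrix N N ℂ)) : Submodule ℂ (Matrix N N ℂ) where
  carrier := {X | X ∈ g ∧ X.IsDiag}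
  add_mem' := fun hX hY => ⟨add_mem hX.1 hY.1, hX.2.add hY.2⟩
  zero_mem' := ⟨zero_mem g, Matrix.isDiag_zero⟩
  smul_mem' := fun c _ hX => ⟨g.smul_mem c hX.1, hX.2.smul c⟩

/-- The functional on the Cartan subalgebra that reads off the `p`-th diagonal entry. -/
def coord (g : LieSubalgebra ℂ (Matrix N N ℂ)) (p : N) : Module.Dual ℂ (cartan g) where
  toFun := fun H => (H : Matrix N N ℂ) p p
  map_add' := fun _ _ => rfl
  map_smul' := fun _ _ => rfl

/-- The roots of the pair `(a, h)`: the nonzero functionals `α` on `h` for which some nonzero `X ∈ a`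
satisfies `[H, X] = α(H) X` for all `H ∈ h`. -/
def roots (a : LieSubalgebra ℂ (Matrix N N ℂ)) (h : Submodule ℂ (Matrix N N ℂ)) :
    Set (Module.Dual ℂ h) :=
  {α | α ≠ 0 ∧ ∃ X ∈ a, X ≠ 0 ∧ ∀ H : h, ⁅(H : Matrix N N ℂ), X⁆ = α H • X}

/-- The complexified isotropy algebra `𝔨^ℂ`: the block diagonal matrices of `g`. -/
def isotropyComplex (g : LieSubalgebra ℂ (Matrix N N ℂ)) (β : N → B) :
    LieSubalgebra ℂ (Matrix N N ℂ) where
  carrier := {X | X ∈ g ∧ ∀ p q, β p ≠ β q → X p q = 0}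
  add_mem' := fun {X Y} hX hY => ⟨add_mem hX.1 hY.1, fun p q h => by
    rw [Matrix.add_apply, hX.2 p q h, hY.2 p q h, add_zero]⟩
  zero_mem' := ⟨zero_mem g, fun _ _ _ => rfl⟩
  smul_mem' := fun c X hX => ⟨g.smul_mem c hX.1, fun p q h => by
    rw [Matrix.smul_apply, hX.2 p q h, smul_zero]⟩
  lie_mem' := fun {X Y} hX hY => ⟨g.lie_mem hX.1 hY.1, fun p q h => by
    have key : ∀ Z W : Matrix N N ℂ, (∀ p q, β p ≠ β q → Z p q = 0) →
        (∀ p q, β p ≠ β q → W p q = 0) → (Z * W) p q = 0 := by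
      intro Z W hZ hW
      rw [Matrix.mul_apply]
      refine Finset.sum_eq_zero fun l _ => ?_
      by_cases hl : β p = β l
      · rw [hW l q (fun h' => h (hl.trans h')), mul_zero]
      · rw [hZ p l hl, zero_mul]
    rw [Ring.lie_def, Matrix.sub_apply, key X Y hX.2 hY.2, key Y X hY.2 hX.2, sub_zero]⟩

/-- The compact real form `𝔲`: the skew-Hermitian matrices of `g`. -/
def compactForm (g : LieSubalgebra ℂ (Matrix N N ℂ)) : LieSubalgebra ℝ (Matrix N N ℂ) where
  carrier := {X | X ∈ g ∧ X.conjTranspose = -X}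
  add_mem' := fun {X Y} hX hY => ⟨add_mem hX.1 hY.1, by
    rw [Matrix.conjTranspose_add, hX.2, hY.2, neg_add]⟩
  zero_mem' := ⟨zero_mem g, by simp⟩
  smul_mem' := fun c X hX => ⟨by
    have h := g.smul_mem (c : ℂ) hX.1
    rwa [Complex.coe_smul] at h, by
    rw [Matrix.conjTranspose_smul, hX.2, star_trivial, smul_neg]⟩
  lie_mem' := fun {X Y} hX hY => ⟨g.lie_mem hX.1 hY.1, by
    rw [Ring.lie_def, Matrix.conjTranspose_sub, Matrix.conjTranspose_mul,
      Matrix.conjTranspose_mul, hX.2, hY.2]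
    noncomm_ring⟩

/-- The isotropy algebra `𝔨 = 𝔲 ∩ 𝔨^ℂ`, as a Lie subalgebra of `𝔲`. -/
def isotropy (g : LieSubalgebra ℂ (Matrix N N ℂ)) (β : N → B) :
    LieSubalgebra ℝ (compactForm g) where
  carrier := {X | (X : Matrix N N ℂ) ∈ isotropyComplex g β}
  add_mem' := fun {_ _} hX hY => (isotropyComplex g β).add_mem hX hY
  zero_mem' := zero_mem (isotropyComplex g β)
  smul_mem' := fun c X hX => by
    have h := (isotropyComplex g β).smul_mem (c : ℂ) hX
    rwa [Complex.coe_smul] at h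
  lie_mem' := fun {_ _} hX hY => (isotropyComplex g β).lie_mem hX hY

/-- The tangent space `𝔪` at the origin: the orthogonal complement of `𝔨` in `𝔲` with respect to the
Killing form, with the adjoint action of `𝔨`. -/
def tangent (g : LieSubalgebra ℂ (Matrix N N ℂ)) (β : N → B) :
    LieSubmodule ℝ (isotropy g β) (compactForm g) where
  carrier := {X | ∀ Y ∈ isotropy g β, killingForm ℝ (compactForm g) X Y = 0}
  add_mem' := fun {X Z} hX hZ Y hY => by
    rw [map_add, LinearMap.add_apply, hX Y hY, hZ Y hY, add_zero]
  zero_mem' := fun Y _ => by rw [map_zero, LinearMap.zero_apply]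
  smul_mem' := fun c X hX Y hY => by
    rw [map_smul, LinearMap.smul_apply, hX Y hY, smul_zero]
  lie_mem := fun {Z X} hX Y hY => by
    change killingForm ℝ (compactForm g) ⁅(Z : compactForm g), X⁆ Y = 0
    rw [← lie_skew, map_neg, LinearMap.neg_apply, LieModule.traceForm_apply_lie_apply,
      hX _ ((isotropy g β).lie_mem Z.2 hY), neg_zero]

/-- `𝔪` is the internal direct sum of the irreducible `ad(𝔨)`-submodules `W i`. -/
def IsIsotropyDecomposition (g : LieSubalgebra ℂ (Matrix N N ℂ)) (β : N → B) {k : ℕ}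
    (W : Fin k → LieSubmodule ℝ (isotropy g β) (compactForm g)) : Prop :=
  (∀ i, LieModule.IsIrreducible ℝ (isotropy g β) (W i)) ∧ iSupIndep W ∧ ⨆ i, W i = tangent g β

/-- `𝔪` splits into irreducible `ad(𝔨)`-submodules, and each such splitting has exactly `k` terms. -/
def HasIsotropySummands (g : LieSubalgebra ℂ (Matrix N N ℂ)) (β : N → B) (k : ℕ) : Prop :=
  (∃ W : Fin k → LieSubmodule ℝ (isotropy g β) (compactForm g),
      IsIsotropyDecomposition g β W) ∧
    ∀ (l : ℕ) (W : Fin l → LieSubmodule ℝ (isotropy g β) (compactForm g)),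
      IsIsotropyDecomposition g β W → l = k

/-- `𝔱 = Z(𝔨^ℂ) ∩ i𝔥_ℝ`, where `i𝔥_ℝ = 𝔥 ∩ 𝔲` is the space of skew-Hermitian diagonal matrices
of `g`. -/
def tSpace (g : LieSubalgebra ℂ (Matrix N N ℂ)) (β : N → B) : Submodule ℝ (Matrix N N ℂ) where
  carrier := {H | H ∈ cartan g ∧ H ∈ compactForm g ∧ ∀ X ∈ isotropyComplex g β, ⁅H, X⁆ = 0}
  add_mem' := fun {H H'} hH hH' => ⟨add_mem hH.1 hH'.1, add_mem hH.2.1 hH'.2.1, fun X hX => by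
    rw [add_lie, hH.2.2 X hX, hH'.2.2 X hX, add_zero]⟩
  zero_mem' := ⟨zero_mem _, zero_mem _, fun X _ => zero_lie X⟩
  smul_mem' := fun c H hH => ⟨by
    have h := (cartan g).smul_mem (c : ℂ) hH.1
    rwa [Complex.coe_smul] at h, (compactForm g).smul_mem c hH.2.1, fun X hX => by
    rw [smul_lie, hH.2.2 X hX, smul_zero]⟩

/-- The restriction map `k(α) = α|_𝔱`. -/
def restrictT (g : LieSubalgebra ℂ (Matrix N N ℂ)) (β : N → B) (α : Module.Dual ℂ (cartan g)) :
    tSpace g β →ₗ[ℝ] ℂ where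
  toFun := fun H => α ⟨H.1, H.2.1⟩
  map_add' := fun H H' => α.map_add ⟨H.1, H.2.1⟩ ⟨H'.1, H'.2.1⟩
  map_smul' := fun c H => by
    have h := α.map_smul (c : ℂ) ⟨H.1, H.2.1⟩
    rw [smul_eq_mul] at h
    rw [RingHom.id_apply, Complex.real_smul, ← h]
    congr 1

/-- The positive t-roots `Π_𝔱⁺ = k(Π_M⁺)`, where `Π_M = Π ∖ Π_Θ`, `Π` and `Π_Θ` are the roots of `g`
and of `𝔨^ℂ`, and `pos` is the chosen set of positive roots of `g`. -/
def positiveTRoots (g : LieSubalgebra ℂ (Matrix N N ℂ)) (β : N → B)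
    (pos : Set (Module.Dual ℂ (cartan g))) : Set (tSpace g β →ₗ[ℝ] ℂ) :=
  restrictT g β '' ((roots g (cartan g) \ roots (isotropyComplex g β) (cartan g)) ∩ pos)

end General

/-! ### Coordinates

`d : Fin r → ℕ` lists the sizes of the unitary factors, and `t` is the rank of the remaining
orthogonal or symplectic factor. The coordinates of the Cartan subalgebra are listed block by block,
the last `t` of them belonging to the remaining factor. -/

section Coordinates

variable {r : ℕ}

/-- The coordinates belonging to unitary factors: the pair `⟨i, a⟩` is the `a`-th coordinate of the
`i`-th factor. -/
abbrev UIndex (d : Fin r → ℕ) : Type := Σ i : Fin r, Fin (d i)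

/-- All coordinates; there are `∑ d i + t` of them. -/
abbrev Index (d : Fin r → ℕ) (t : ℕ) : Type := UIndex d ⊕ Fin t

/-- The order of the coordinates of the unitary factors (lexicographic). -/
def UIndex.precedes (d : Fin r → ℕ) : UIndex d → UIndex d → Prop :=
  Sigma.Lex (fun i j => i < j) (fun _ a b => a < b)

/-- The order of all the coordinates: the last `t` come after the others. -/
def Index.precedes (d : Fin r → ℕ) (t : ℕ) : Index d t → Index d t → Prop :=
  Sum.Lex (UIndex.precedes d) (fun a b => a < b)

/-- The block of a coordinate; `none` is the block of the remaining factor. -/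
def Index.block (d : Fin r → ℕ) (t : ℕ) : Index d t → Option (Fin r)
  | Sum.inl x => some x.1
  | Sum.inr _ => none

end Coordinates

/-! ### Type A: `SU(n) / S(U(d₁) × ⋯ × U(d_r))`, with `n = ∑ d i` -/

section TypeA

variable {r : ℕ}

/-- `𝔰𝔩(n, ℂ)`. -/
abbrev gA (d : Fin r → ℕ) : LieSubalgebra ℂ (Matrix (UIndex d) (UIndex d) ℂ) :=
  LieAlgebra.SpecialLinear.sl (UIndex d) ℂ

/-- The blocks of `S(U(d₁) × ⋯ × U(d_r))`. -/
def blockA (d : Fin r → ℕ) : UIndex d → Fin r := fun p => p.1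

/-- The positive roots `ε_p - ε_q`, for `p` before `q`. -/
def posA (d : Fin r → ℕ) : Set (Module.Dual ℂ (cartan (gA d))) :=
  {α | ∃ p q, UIndex.precedes d p q ∧ α = coord (gA d) p - coord (gA d) q}

end TypeA

/-! ### Blocks for types B, C, D

The matrices have rows and columns indexed by two copies of the coordinates (preceded, in type B, by
one more index), and the diagonal matrices are `diag(ε, -ε)` (in type B, `diag(0, ε, -ε)`).
Block diagonal matrices are made of pairs `A, -Aᵀ` with `A ∈ 𝔤𝔩(d i)`, one pair for each `i`, and of
one matrix in the orthogonal or symplectic Lie algebra of rank `t`. -/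

section BlocksBCD

variable {r : ℕ}

/-- The blocks of `U(d₁) × ⋯ × U(d_r) × Sp(t)` or of `U(d₁) × ⋯ × U(d_r) × SO(2t)`: two for each
unitary factor, and the block `none` of the remaining factor. -/
def blockCD (d : Fin r → ℕ) (t : ℕ) : Index d t ⊕ Index d t → Option (Fin r × Bool)
  | Sum.inl p => (Index.block d t p).map (fun i => (i, true))
  | Sum.inr p => (Index.block d t p).map (fun i => (i, false))

/-- The blocks of `U(d₁) × ⋯ × U(d_r) × SO(2t+1)`. -/
def blockB (d : Fin r → ℕ) (t : ℕ) : Unit ⊕ (Index d t ⊕ Index d t) → Option (Fin r × Bool)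
  | Sum.inl _ => none
  | Sum.inr p => blockCD d t p

end BlocksBCD

/-! ### Type B: `SO(2n+1) / U(d₁) × ⋯ × U(d_r) × SO(2t+1)`, with `n = ∑ d i + t` -/

section TypeB

variable {r : ℕ}

/-- The symmetric form with matrix `[[1, 0, 0], [0, 0, I], [0, I, 0]]`. -/
def formB (d : Fin r → ℕ) (t : ℕ) :
    Matrix (Unit ⊕ (Index d t ⊕ Index d t)) (Unit ⊕ (Index d t ⊕ Index d t)) ℂ :=
  Matrix.fromBlocks 1 0 0 (LieAlgebra.Orthogonal.JD (Index d t) ℂ)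

/-- `𝔰𝔬(2n+1, ℂ)`: the matrices `[[0, b, c], [-cᵀ, x, y], [-bᵀ, z, -xᵀ]]` with `y, z` skew. -/
abbrev gB (d : Fin r → ℕ) (t : ℕ) :
    LieSubalgebra ℂ
      (Matrix (Unit ⊕ (Index d t ⊕ Index d t)) (Unit ⊕ (Index d t ⊕ Index d t)) ℂ) :=
  skewAdjointMatricesLieSubalgebra (formB d t)

/-- The functional `ε_p`. -/
def epsB (d : Fin r → ℕ) (t : ℕ) (p : Index d t) : Module.Dual ℂ (cartan (gB d t)) :=
  coord (gB d t) (Sum.inr (Sum.inl p))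

/-- The positive roots `ε_p`, `ε_p - ε_q` and `ε_p + ε_q`, for `p` before `q`. -/
def posB (d : Fin r → ℕ) (t : ℕ) : Set (Module.Dual ℂ (cartan (gB d t))) :=
  {α | ∃ p, α = epsB d t p} ∪
    {α | ∃ p q, Index.precedes d t p q ∧
      (α = epsB d t p - epsB d t q ∨ α = epsB d t p + epsB d t q)}

end TypeB

/-! ### Type C: `Sp(n) / U(d₁) × ⋯ × U(d_r) × Sp(t)`, with `n = ∑ d i + t` -/

section TypeC

variable {r : ℕ}

/-- `𝔰𝔭(n, ℂ)`: the matrices `[[x, y], [z, -xᵀ]]` with `y, z` symmetric. -/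
abbrev gC (d : Fin r → ℕ) (t : ℕ) :
    LieSubalgebra ℂ (Matrix (Index d t ⊕ Index d t) (Index d t ⊕ Index d t) ℂ) :=
  LieAlgebra.Symplectic.sp (Index d t) ℂ

/-- The functional `ε_p`. -/
def epsC (d : Fin r → ℕ) (t : ℕ) (p : Index d t) : Module.Dual ℂ (cartan (gC d t)) :=
  coord (gC d t) (Sum.inl p)

/-- The positive roots `2ε_p`, `ε_p - ε_q` and `ε_p + ε_q`, for `p` before `q`. -/
def posC (d : Fin r → ℕ) (t : ℕ) : Set (Module.Dual ℂ (cartan (gC d t))) :=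
  {α | ∃ p, α = (2 : ℂ) • epsC d t p} ∪
    {α | ∃ p q, Index.precedes d t p q ∧
      (α = epsC d t p - epsC d t q ∨ α = epsC d t p + epsC d t q)}

end TypeC

/-! ### Type D: `SO(2n) / U(d₁) × ⋯ × U(d_r) × SO(2t)`, with `n = ∑ d i + t` -/

section TypeD

variable {r : ℕ}

/-- `𝔰𝔬(2n, ℂ)`: the matrices `[[x, y], [z, -xᵀ]]` with `y, z` skew-symmetric. -/
abbrev gD (d : Fin r → ℕ) (t : ℕ) :
    LieSubalgebra ℂ (Matrix (Index d t ⊕ Index d t) (Index d t ⊕ Index d t) ℂ) :=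
  LieAlgebra.Orthogonal.typeD (Index d t) ℂ

/-- The functional `ε_p`. -/
def epsD (d : Fin r → ℕ) (t : ℕ) (p : Index d t) : Module.Dual ℂ (cartan (gD d t)) :=
  coord (gD d t) (Sum.inl p)

/-- The positive roots `ε_p - ε_q` and `ε_p + ε_q`, for `p` before `q`. -/
def posD (d : Fin r → ℕ) (t : ℕ) : Set (Module.Dual ℂ (cartan (gD d t))) :=
  {α | ∃ p q, Index.precedes d t p q ∧
    (α = epsD d t p - epsD d t q ∨ α = epsD d t p + epsD d t q)}

end TypeD

/-- The number of isotropy summands and the number of positive t-roots are both equal to `k`. -/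
def SummandCount {N B : Type} [Fintype N] [DecidableEq N] (g : LieSubalgebra ℂ (Matrix N N ℂ))
    (β : N → B) (pos : Set (Module.Dual ℂ (cartan g))) (k : ℕ) : Prop :=
  HasIsotropySummands g β k ∧ (positiveTRoots g β pos).encard = (k : ℕ∞)

end FlagManifold

end

noncomputable section

attribute [local instance 100] LieRing.ofAssociativeRing

namespace FlagManifold

/-! ### Eigenvector components -/

section Components

/-! Give each block of rows a real weight: `5 ^ (r - i)` for the `i`-th unitary factor, its negative
on the dual copy (types B, C, D), and 0 on the remaining factor; in type A the weights are recentred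
to trace zero. The matrix H = i·diag(wt) lies in 𝔱, hence commutes with 𝔨, and ad(H)² multiplies the
matrix unit at (p, q) by -(wt p - wt q)². Everything is read off from this one operator.

Since ad(H)² is diagonalisable and commutes with 𝔨, every ad(𝔨)-submodule of 𝔲 is the sum of its
eigencomponents. The kernel is 𝔨, and orthogonality together with definiteness of the Killing form
shows that 𝔪 is the sum of the eigenspaces m_ω with ω > 0 (`weightSummand_le_tangent`,
`iSup_weightSummand`). Each m_ω is irreducible: Y ↦ Y - Yᴴ identifies it with the graded piece g_ω,
a submodule of m_ω becomes a complex 𝔨^ℂ-submodule of g_ω (`complexification`), a nonzero one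
contains a root vector, and brackets with root vectors of 𝔨^ℂ reach all the other root vectors of
g_ω. The eigenvalues being distinct, an irreducible submodule of 𝔪 is one of the m_ω
(`exists_eq_weightSummand`). So the decomposition is unique and has one term per positive weight.

Powers of 5 are used because a nonzero sum of two signed powers determines its summands
(`IsSignedPower.eq_of_add_eq_add`). Hence two roots with the same nonzero value at H agree on all of
𝔱, and evaluation at H puts positive t-roots in bijection with positive weights
(`encard_positiveTRoots`).

It remains to count weights. Type A has w_i - w_j for i < j. Types B, C, D are treated together
through `IsPairedFrame`: w_i ± w_j for i < j give r(r-1) weights; w_i occurs if some row has weight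
0; 2w_i always occurs in type C, but in types B and D only if d_i > 1, because a matrix skew for a
symmetric form has zero entry at (p, σ p). -/

theorem sum_filter_eigenvalue_mem {K E ι : Type*} [Field K] [AddCommGroup E] [Module K E]
    (f : Module.End K E) (W : Submodule K E) (hW : ∀ x ∈ W, f x ∈ W) (s : Finset ι) (y : ι → E)
    (μ : ι → K) [DecidableEq K] (hy : ∀ i ∈ s, f (y i) = μ i • y i) (hx : ∑ i ∈ s, y i ∈ W)
    (c : K) : ∑ i ∈ s with μ i = c, y i ∈ W := by
  -- P is 1 at c and 0 at the other eigenvalues, so P(f) projects onto the c-component; a subspace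
  -- stable under f is stable under P(f).
  set P : Polynomial K :=
    Lagrange.interpolate (s.image μ) id (fun a => if a = c then 1 else 0) with hP
  have hmem : ∀ Q : Polynomial K, ∀ x ∈ W, Polynomial.aeval f Q x ∈ W := by
    intro Q
    induction Q using Polynomial.induction_on' with
    | add p q hp hq =>
      intro x hx
      rw [map_add, LinearMap.add_apply]
      exact add_mem (hp x hx) (hq x hx)
    | monomial n a =>
      intro x hx
      rw [Polynomial.aeval_monomial, Module.End.mul_apply, Module.algebraMap_end_apply]
      refine W.smul_mem a ?_
      induction n with
      | zero => simpa using hx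
      | succ n ih => rw [pow_succ', Module.End.mul_apply]; exact hW _ ih
  have heval : ∀ i ∈ s, Polynomial.aeval f P (y i) = if μ i = c then y i else 0 := by
    intro i hi
    have h1 : Polynomial.aeval f P (y i) = P.eval (μ i) • y i := by
      by_cases h0 : y i = 0
      · simp [h0]
      · exact Module.End.aeval_apply_of_hasEigenvector
          ⟨Module.End.mem_eigenspace_iff.2 (hy i hi), h0⟩
    have h2 : P.eval (μ i) = if μ i = c then 1 else 0 := by
      have := Lagrange.eval_interpolate_at_node (s := s.image μ) (v := (id : K → K))
        (fun a => if a = c then (1 : K) else 0) (Set.injOn_id _) (Finset.mem_image_of_mem μ hi)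
      simpa [hP] using this
    rw [h1, h2]
    split_ifs <;> simp
  have := hmem P _ hx
  rwa [map_sum, Finset.sum_congr rfl heval, ← Finset.sum_filter] at this

variable {N : Type}

open Classical in
/-- The matrix obtained from `X` by keeping the entries at the positions satisfying `P`. -/
def mask (P : N → N → Prop) (X : Matrix N N ℂ) : Matrix N N ℂ :=
  Matrix.of fun p q => if P p q then X p q else 0

theorem mask_apply_of_pos {P : N → N → Prop} {p q : N} (h : P p q) (X : Matrix N N ℂ) :
    mask P X p q = X p q := by
  simp [mask, h]

theorem mask_apply_of_neg {P : N → N → Prop} {p q : N} (h : ¬ P p q) (X : Matrix N N ℂ) :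
    mask P X p q = 0 := by
  simp [mask, h]

theorem of_mask_apply_ne_zero {P : N → N → Prop} {p q : N} {X : Matrix N N ℂ}
    (h : mask P X p q ≠ 0) : P p q ∧ X p q ≠ 0 := by
  by_cases hP : P p q
  · exact ⟨hP, by rwa [mask_apply_of_pos hP] at h⟩
  · exact absurd (mask_apply_of_neg hP X) h

variable [Fintype N] [DecidableEq N]

/-- Matrix units diagonalise `f`, so a mask on a level set of μ is an eigencomponent. The field K is
ℂ for subspaces of `g` and ℝ for subspaces of 𝔲; over ℝ each position carries the whole plane of
values z. -/
theorem mask_mem {K : Type*} [Field K] [Algebra K ℂ] (f : Module.End K (Matrix N N ℂ))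
    (μ : N → N → K) (hf : ∀ p q z, f (Matrix.single p q z) = μ p q • Matrix.single p q z)
    (W : Submodule K (Matrix N N ℂ)) (hW : ∀ x ∈ W, f x ∈ W) {X : Matrix N N ℂ} (hX : X ∈ W)
    (c : K) : mask (fun p q => μ p q = c) X ∈ W := by
  classical
  have h := sum_filter_eigenvalue_mem f W hW (Finset.univ : Finset (N × N))
    (fun x => Matrix.single x.1 x.2 (X x.1 x.2)) (fun x => μ x.1 x.2) (fun x _ => hf _ _ _)
    (by
      rw [Fintype.sum_prod_type, ← Matrix.matrix_eq_sum_single X]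
      exact hX) c
  convert h using 1
  ext p q
  rw [Finset.sum_filter, Matrix.sum_apply, Fintype.sum_prod_type]
  rw [Finset.sum_eq_single p, Finset.sum_eq_single q]
  · by_cases hc : μ p q = c <;> simp [mask, hc]
  · intro b _ hb
    split_ifs <;> simp [hb]
  · simp
  · intro b _ hb
    refine Finset.sum_eq_zero fun j _ => ?_
    split_ifs <;> simp [hb]
  · simp

omit [DecidableEq N] in
/-- The components of a matrix add up to the matrix. -/
theorem sum_mask {α : Type*} [DecidableEq α] (μ : N → N → α) (X : Matrix N N ℂ) :
    X = ∑ c ∈ Finset.univ.image (fun x : N × N => μ x.1 x.2), mask (fun p q => μ p q = c) X := by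
  ext p q
  rw [Matrix.sum_apply, Finset.sum_eq_single (μ p q)]
  · exact (mask_apply_of_pos (P := fun a b => μ a b = μ p q) rfl X).symm
  · intro c _ hc
    exact mask_apply_of_neg (fun h => hc h.symm) X
  · intro h
    exact absurd (Finset.mem_image_of_mem (fun x : N × N => μ x.1 x.2)
      (Finset.mem_univ ((p, q) : N × N))) h

theorem lie_diagonal_apply (h : N → ℂ) (X : Matrix N N ℂ) (p q : N) :
    ⁅Matrix.diagonal h, X⁆ p q = (h p - h q) * X p q := by
  rw [Ring.lie_def, Matrix.sub_apply, Matrix.diagonal_mul, Matrix.mul_diagonal]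
  ring

theorem lie_isDiag_apply {H : Matrix N N ℂ} (hH : H.IsDiag) (X : Matrix N N ℂ) (p q : N) :
    ⁅H, X⁆ p q = (H p p - H q q) * X p q := by
  conv_lhs => rw [← hH.diagonal_diag]
  exact lie_diagonal_apply _ X p q

theorem mask_lie_diagonal_mem (h : N → ℂ) (W : Submodule ℂ (Matrix N N ℂ))
    (hW : ∀ X ∈ W, ⁅Matrix.diagonal h, X⁆ ∈ W) {X : Matrix N N ℂ} (hX : X ∈ W) (c : ℂ) :
    mask (fun p q => h p - h q = c) X ∈ W := by
  refine mask_mem (LieAlgebra.ad ℂ (Matrix N N ℂ) (Matrix.diagonal h)) (fun p q => h p - h q)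
    ?_ W hW hX c
  intro p q z
  ext i j
  rw [LieAlgebra.ad_apply, lie_diagonal_apply, Matrix.smul_apply, smul_eq_mul]
  by_cases hij : p = i ∧ q = j
  · rw [hij.1, hij.2]
  · rw [Matrix.single_apply_of_ne _ _ _ _ _ hij, mul_zero, mul_zero]

/-- The skew-Hermitian diagonal matrix with diagonal entries `i wt(p)`. -/
def gradingElement (wt : N → ℝ) : Matrix N N ℂ := Matrix.diagonal fun p => Complex.I * wt p

theorem lie_gradingElement_apply (wt : N → ℝ) (X : Matrix N N ℂ) (p q : N) :
    ⁅gradingElement wt, X⁆ p q = Complex.I * ((wt p - wt q : ℝ) : ℂ) * X p q := by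
  rw [gradingElement, lie_diagonal_apply]
  push_cast
  ring

theorem lie_lie_gradingElement_apply (wt : N → ℝ) (X : Matrix N N ℂ) (p q : N) :
    ⁅gradingElement wt, ⁅gradingElement wt, X⁆⁆ p q = ((-(wt p - wt q) ^ 2 : ℝ) : ℂ) * X p q := by
  rw [lie_gradingElement_apply, lie_gradingElement_apply, ← mul_assoc]
  congr 1
  push_cast
  linear_combination ((wt p - wt q : ℂ)) ^ 2 * Complex.I_mul_I

theorem mask_mem_of_lie_gradingElement_mem (wt : N → ℝ) (W : Submodule ℂ (Matrix N N ℂ))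
    (hW : ∀ X ∈ W, ⁅gradingElement wt, X⁆ ∈ W) {X : Matrix N N ℂ} (hX : X ∈ W) (ω : ℝ) :
    mask (fun p q => wt p - wt q = ω) X ∈ W := by
  have := mask_lie_diagonal_mem _ W hW hX (Complex.I * ω)
  convert this using 4 with p q
  rw [← mul_sub, mul_right_inj' Complex.I_ne_zero, ← Complex.ofReal_sub, Complex.ofReal_inj]

/-- The eigenvalues of ad(H) are imaginary, so over ℝ only its square can be used; this merges the
weights ω and -ω. -/
theorem mask_sq_mem_of_lie_gradingElement_mem (wt : N → ℝ) (W : Submodule ℝ (Matrix N N ℂ))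
    (hW : ∀ X ∈ W, ⁅gradingElement wt, X⁆ ∈ W) {X : Matrix N N ℂ} (hX : X ∈ W) (c : ℝ) :
    mask (fun p q => (wt p - wt q) ^ 2 = c) X ∈ W := by
  have := mask_mem (LieAlgebra.ad ℝ (Matrix N N ℂ) (gradingElement wt) ∘ₗ
    LieAlgebra.ad ℝ (Matrix N N ℂ) (gradingElement wt)) (fun p q => -(wt p - wt q) ^ 2)
    (by
      intro p q z
      ext i j
      rw [LinearMap.comp_apply, LieAlgebra.ad_apply, LieAlgebra.ad_apply,
        lie_lie_gradingElement_apply, Matrix.smul_apply, Complex.real_smul]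
      by_cases hij : p = i ∧ q = j
      · rw [hij.1, hij.2]
      · rw [Matrix.single_apply_of_ne _ _ _ _ _ hij, mul_zero, mul_zero])
    W (fun x hx => hW _ (hW _ hx)) hX (-c)
  simpa only [neg_inj] using this

end Components

/-! ### The trace of the square of a skew operator -/

/-- In an orthonormal basis for B, the trace of A² is minus the sum of the squared lengths of the
vectors A b. -/
theorem eq_zero_of_trace_mul_self_eq_zero {V : Type*} [AddCommGroup V] [Module ℝ V]
    [FiniteDimensional ℝ V] (B : V →ₗ[ℝ] V →ₗ[ℝ] ℝ) (hsymm : ∀ x y, B x y = B y x)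
    (hpos : ∀ x, 0 ≤ B x x) (hdef : ∀ x, B x x = 0 → x = 0) (A : Module.End ℝ V)
    (hA : ∀ x y, B (A x) y = - B x (A y)) (htr : LinearMap.trace ℝ V (A ∘ₗ A) = 0) : A = 0 := by
  let core : InnerProductSpace.Core ℝ V :=
    { inner := fun x y => B x y
      conj_inner_symm := fun x y => hsymm y x
      re_inner_nonneg := hpos
      add_left := fun x y z => by simp
      smul_left := fun x y r => by simp
      definite := hdef }
  let _ : NormedAddCommGroup V := core.toNormedAddCommGroup
  let _ : InnerProductSpace ℝ V := InnerProductSpace.ofCore core.toCore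
  have hin : ∀ x y : V, inner ℝ x y = B x y := fun _ _ => rfl
  let b := stdOrthonormalBasis ℝ V
  rw [LinearMap.trace_eq_sum_inner _ b] at htr
  have h0 : ∑ i, B (A (b i)) (A (b i)) = 0 := by
    rw [← neg_eq_zero, ← Finset.sum_neg_distrib, ← htr]
    refine Finset.sum_congr rfl fun i _ => ?_
    rw [hin, LinearMap.comp_apply, hA, neg_neg]
  rw [Finset.sum_eq_zero_iff_of_nonneg fun i _ => hpos _] at h0
  refine b.toBasis.ext fun i => ?_
  rw [LinearMap.zero_apply, b.coe_toBasis]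
  exact hdef _ (h0 i (Finset.mem_univ i))

/-! ### The isotropy decomposition defined by a weight function -/

section Grading

variable {N B : Type} [Fintype N] [DecidableEq N]

/-- A weight function on the rows of the matrices whose level sets are the blocks, and whose
positive graded pieces of `g` are irreducible under `𝔨^ℂ`. -/
structure IsIrreducibleGrading (g : LieSubalgebra ℂ (Matrix N N ℂ)) (β : N → B) (wt : N → ℝ) :
    Prop where
  conjTranspose_mem : ∀ X ∈ g, X.conjTranspose ∈ g
  gradingElement_mem : gradingElement wt ∈ g
  wt_eq_iff : ∀ p q, wt p = wt q ↔ β p = β q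
  eq_zero_of_lie_eq_zero : ∀ X ∈ g, (∀ Y ∈ g, ⁅X, Y⁆ = 0) → X = 0
  irreducible : ∀ ω > 0, ∀ W : Submodule ℂ (Matrix N N ℂ),
    (∀ X ∈ W, X ∈ g ∧ ∀ p q, X p q ≠ 0 → wt p - wt q = ω) →
    (∀ Z ∈ isotropyComplex g β, ∀ X ∈ W, ⁅Z, X⁆ ∈ W) → W ≠ ⊥ →
    ∀ X ∈ g, (∀ p q, X p q ≠ 0 → wt p - wt q = ω) → X ∈ W

/-- The positive differences of weights at which `g` does not vanish. -/
def positiveWeights (g : LieSubalgebra ℂ (Matrix N N ℂ)) (wt : N → ℝ) : Set ℝ :=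
  {ω | 0 < ω ∧ ∃ p q, (∃ X ∈ g, X p q ≠ 0) ∧ wt p - wt q = ω}

theorem positiveWeights_finite (g : LieSubalgebra ℂ (Matrix N N ℂ)) (wt : N → ℝ) :
    (positiveWeights g wt).Finite := by
  refine (Set.finite_range fun x : N × N => wt x.1 - wt x.2).subset ?_
  rintro ω ⟨-, p, q, -, h⟩
  exact ⟨(p, q), h⟩

/-- The elements of `𝔲` of weight `± ω`. -/
def weightSummand (g : LieSubalgebra ℂ (Matrix N N ℂ)) (β : N → B) (wt : N → ℝ)
    (hwt : ∀ p q, wt p = wt q ↔ β p = β q) (ω : ℝ) :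
    LieSubmodule ℝ (isotropy g β) (compactForm g) where
  carrier := {X | ∀ p q, (X : Matrix N N ℂ) p q ≠ 0 → (wt p - wt q) ^ 2 = ω ^ 2}
  add_mem' := fun {X Y} hX hY p q h => by
    by_cases h0 : (X : Matrix N N ℂ) p q = 0
    · refine hY p q fun h1 => h ?_
      change (X : Matrix N N ℂ) p q + (Y : Matrix N N ℂ) p q = 0
      rw [h0, h1, add_zero]
    · exact hX p q h0
  zero_mem' := fun p q h => absurd rfl h
  smul_mem' := fun c X hX p q h => hX p q fun h0 => h (by
    change c • (X : Matrix N N ℂ) p q = 0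
    rw [h0, smul_zero])
  -- Nonzero entries of Z join only rows of equal weight, so a product with Z creates no new weight
  -- difference.
  lie_mem := fun {Z X} hX p q h => by
    have hZ := Z.2.2
    change ((Z : Matrix N N ℂ) * (X : Matrix N N ℂ) - (X : Matrix N N ℂ) * (Z : Matrix N N ℂ)) p q
      ≠ 0 at h
    by_contra hne
    refine h ?_
    rw [Matrix.sub_apply, Matrix.mul_apply, Matrix.mul_apply, Finset.sum_eq_zero,
      Finset.sum_eq_zero, sub_zero]
    · intro l _
      by_cases hb : β l = β q
      · rw [show (X : Matrix N N ℂ) p l = 0 from ?_, zero_mul]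
        by_contra h0
        exact hne ((hwt l q).2 hb ▸ hX p l h0)
      · rw [hZ l q hb, mul_zero]
    · intro l _
      by_cases hb : β p = β l
      · rw [show (X : Matrix N N ℂ) l q = 0 from ?_, mul_zero]
        by_contra h0
        exact hne ((hwt p l).2 hb ▸ hX l q h0)
      · rw [hZ p l hb, zero_mul]

omit [Fintype N] in
theorem conjTranspose_gradingElement (wt : N → ℝ) :
    (gradingElement wt).conjTranspose = -gradingElement wt := by
  rw [gradingElement, Matrix.diagonal_conjTranspose]
  ext p q
  by_cases h : p = q
  · subst h; simp
  · simp [h]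

/-- A *-closed complex Lie algebra is the complexification of its skew-Hermitian part. This carries
statements about 𝔲 and 𝔨 over to `g` and 𝔨^ℂ. -/
theorem exists_skewHermitian_decomposition {L : LieSubalgebra ℂ (Matrix N N ℂ)}
    (hL : ∀ X ∈ L, X.conjTranspose ∈ L) {Y : Matrix N N ℂ} (hY : Y ∈ L) :
    ∃ A ∈ L, ∃ C ∈ L, A.conjTranspose = -A ∧ C.conjTranspose = -C ∧ Y = A + Complex.I • C := by
  refine ⟨(1 / 2 : ℂ) • (Y - Y.conjTranspose), L.smul_mem _ (sub_mem hY (hL Y hY)),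
    (-Complex.I / 2) • (Y + Y.conjTranspose), L.smul_mem _ (add_mem hY (hL Y hY)), ?_, ?_, ?_⟩
  · ext p q
    simp
    ring
  · ext p q
    simp
    ring
  · ext p q
    simp
    linear_combination ((Y p q + starRingEnd ℂ (Y q p)) / 2) * Complex.I_mul_I

theorem conjTranspose_mem_isotropyComplex {g : LieSubalgebra ℂ (Matrix N N ℂ)} {β : N → B}
    (hg : ∀ X ∈ g, X.conjTranspose ∈ g) :
    ∀ X ∈ isotropyComplex g β, X.conjTranspose ∈ isotropyComplex g β := fun X hX =>
  ⟨hg X hX.1, fun p q h => by rw [Matrix.conjTranspose_apply, hX.2 q p h.symm, star_zero]⟩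

open ComplexOrder in
/-- The Killing form of the compact form is definite if the centre is trivial. -/
theorem eq_zero_of_killingForm_self_eq_zero {g : LieSubalgebra ℂ (Matrix N N ℂ)}
    (hstar : ∀ X ∈ g, X.conjTranspose ∈ g)
    (hcenter : ∀ X ∈ g, (∀ Y ∈ g, ⁅X, Y⁆ = 0) → X = 0) (X : compactForm g)
    (h : killingForm ℝ (compactForm g) X X = 0) : X = 0 := by
  -- On skew-Hermitian matrices minus the real trace form is the Frobenius inner product, and ad X
  -- is skew for it. As the Killing form at (X, X) is the trace of (ad X)², its vanishing forces ad
  -- X = 0.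
  let T : compactForm g → compactForm g → ℝ := fun X Y =>
    -(Matrix.trace ((X : Matrix N N ℂ) * (Y : Matrix N N ℂ))).re
  let form : compactForm g →ₗ[ℝ] compactForm g →ₗ[ℝ] ℝ := LinearMap.mk₂ ℝ T
    (fun X X' Y => by simp [T, add_mul]; ring) (fun c X Y => by simp [T])
    (fun X Y Y' => by simp [T, mul_add]; ring) (fun c X Y => by simp [T])
  have hform : ∀ X Y, form X Y =
    -(Matrix.trace ((X : Matrix N N ℂ) * (Y : Matrix N N ℂ))).re := fun _ _ => rfl
  have hself : ∀ X, form X X =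
      (Matrix.trace ((X : Matrix N N ℂ).conjTranspose * (X : Matrix N N ℂ))).re := by
    intro X
    rw [hform, X.2.2, neg_mul, Matrix.trace_neg, Complex.neg_re]
  have had : LieAlgebra.ad ℝ (compactForm g) X = 0 := by
    refine eq_zero_of_trace_mul_self_eq_zero form ?_ ?_ ?_ _ ?_ h
    · intro X Y
      rw [hform, hform, Matrix.trace_mul_comm]
    · intro X
      rw [hself]
      exact (Complex.le_def.1 (Matrix.posSemidef_conjTranspose_mul_self
        (X : Matrix N N ℂ)).trace_nonneg).1
    · intro X hX
      rw [hself] at hX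
      have him := (Complex.le_def.1 (Matrix.posSemidef_conjTranspose_mul_self
        (X : Matrix N N ℂ)).trace_nonneg).2
      refine Subtype.ext (Matrix.trace_conjTranspose_mul_self_eq_zero_iff.1 ?_)
      exact Complex.ext hX him.symm
    · intro Y Z
      rw [hform, hform, LieAlgebra.ad_apply, LieAlgebra.ad_apply, LieSubalgebra.coe_bracket,
        LieSubalgebra.coe_bracket, Ring.lie_def, Ring.lie_def, sub_mul, mul_sub,
        Matrix.trace_sub, Matrix.trace_sub, ← mul_assoc, ← mul_assoc,
        Matrix.trace_mul_cycle (Y : Matrix N N ℂ) (Z : Matrix N N ℂ) (X : Matrix N N ℂ)]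
      simp
  -- X commutes with 𝔲, hence with 𝔲 + i𝔲 = `g`, and is central.
  refine Subtype.ext (hcenter X X.2.1 fun Y hY => ?_)
  have hu : ∀ A ∈ g, A.conjTranspose = -A → ⁅(X : Matrix N N ℂ), A⁆ = 0 := by
    intro A hA hA'
    have := LinearMap.congr_fun had (⟨A, hA, hA'⟩ : compactForm g)
    exact congrArg Subtype.val this
  obtain ⟨A, hA, C, hC, hA', hC', rfl⟩ := exists_skewHermitian_decomposition hstar hY
  rw [lie_add, lie_smul, hu A hA hA', hu C hC hC', smul_zero, add_zero]

/-! ### Splitting of 𝔪 into eigenspaces of ad(H)². -/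

namespace IsIrreducibleGrading

variable {g : LieSubalgebra ℂ (Matrix N N ℂ)} {β : N → B} {wt : N → ℝ}

/-- The grading element as an element of `𝔲`. -/
def element (hg : IsIrreducibleGrading g β wt) : compactForm g :=
  ⟨gradingElement wt, hg.gradingElement_mem, conjTranspose_gradingElement wt⟩

theorem element_mem_isotropy (hg : IsIrreducibleGrading g β wt) : hg.element ∈ isotropy g β :=
  ⟨hg.gradingElement_mem, fun _ _ h => Matrix.diagonal_apply_ne _ fun h' => h (congrArg β h')⟩

/-- The components of an element of a `𝔨`-submodule lie in that submodule. -/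
theorem exists_component (hg : IsIrreducibleGrading g β wt)
    (W : LieSubmodule ℝ (isotropy g β) (compactForm g)) {X : compactForm g} (hX : X ∈ W) (c : ℝ) :
    ∃ Y ∈ W, (Y : Matrix N N ℂ) = mask (fun p q => (wt p - wt q) ^ 2 = c) (X : Matrix N N ℂ) := by
  have h := mask_sq_mem_of_lie_gradingElement_mem wt
    ((W : Submodule ℝ (compactForm g)).map (compactForm g).toSubmodule.subtype) ?_
    (X := (X : Matrix N N ℂ)) ⟨X, hX, rfl⟩ c
  · obtain ⟨Y, hY, h⟩ := h
    exact ⟨Y, hY, h⟩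
  · rintro _ ⟨Y, hY, rfl⟩
    exact ⟨_, W.lie_mem (x := (⟨hg.element, hg.element_mem_isotropy⟩ : isotropy g β)) hY, rfl⟩

theorem lie_element_lie_element (hg : IsIrreducibleGrading g β wt) {ω : ℝ} {X : compactForm g}
    (hX : X ∈ weightSummand g β wt hg.wt_eq_iff ω) :
    ⁅hg.element, ⁅hg.element, X⁆⁆ = (-ω ^ 2) • X := by
  refine Subtype.ext ?_
  change ⁅gradingElement wt, ⁅gradingElement wt, (X : Matrix N N ℂ)⁆⁆ =
    (-ω ^ 2) • (X : Matrix N N ℂ)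
  ext p q
  rw [lie_lie_gradingElement_apply, Matrix.smul_apply, Complex.real_smul]
  by_cases h : (X : Matrix N N ℂ) p q = 0
  · rw [h, mul_zero, mul_zero]
  · rw [hX p q h]

/-- For Y in 𝔨, invariance moves H onto Y, where [H, Y] = 0; thus [H, [H, X]] = -ω²X is orthogonal
to Y, and ω ≠ 0. -/
theorem weightSummand_le_tangent (hg : IsIrreducibleGrading g β wt) {ω : ℝ} (hω : ω ≠ 0) :
    weightSummand g β wt hg.wt_eq_iff ω ≤ tangent g β := by
  intro X hX Y hY
  have hY0 : ⁅hg.element, Y⁆ = 0 := by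
    refine Subtype.ext ?_
    change ⁅gradingElement wt, (Y : Matrix N N ℂ)⁆ = 0
    ext p q
    rw [lie_gradingElement_apply]
    by_cases h : β p = β q
    · rw [(hg.wt_eq_iff p q).2 h, sub_self]
      simp
    · rw [hY.2 p q h, mul_zero, Matrix.zero_apply]
  have h := LieModule.traceForm_apply_lie_apply ℝ (compactForm g) (compactForm g)
    ⁅hg.element, X⁆ hg.element Y
  rw [hY0, map_zero, ← lie_skew, map_neg, LinearMap.neg_apply, hg.lie_element_lie_element hX,
    map_smul, LinearMap.smul_apply, smul_eq_mul, neg_eq_zero] at h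
  exact (mul_eq_zero.1 h).resolve_left (neg_ne_zero.2 (pow_ne_zero 2 hω))

theorem eq_zero_of_mem_tangent_of_mem_isotropy (hg : IsIrreducibleGrading g β wt)
    {X : compactForm g} (hX : X ∈ tangent g β) (hX' : X ∈ isotropy g β) : X = 0 :=
  eq_zero_of_killingForm_self_eq_zero hg.conjTranspose_mem hg.eq_zero_of_lie_eq_zero X (hX X hX')

/-- The component of X of weight 0 lies in 𝔪, which is a submodule, and in 𝔨, being block diagonal;
these meet only in 0. -/
theorem apply_eq_zero_of_mem_tangent (hg : IsIrreducibleGrading g β wt) {X : compactForm g}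
    (hX : X ∈ tangent g β) {p q : N} (h : wt p = wt q) : (X : Matrix N N ℂ) p q = 0 := by
  obtain ⟨Y, hY, hYX⟩ := hg.exists_component (tangent g β) hX 0
  have h0 : Y = 0 := by
    refine hg.eq_zero_of_mem_tangent_of_mem_isotropy hY ⟨Y.2.1, fun p q hpq => ?_⟩
    rw [hYX]
    refine mask_apply_of_neg (fun h0 => hpq ?_) _
    rwa [sq_eq_zero_iff, sub_eq_zero, hg.wt_eq_iff] at h0
  rw [← mask_apply_of_pos (P := fun p q => (wt p - wt q) ^ 2 = 0) (p := p) (q := q) (by simp [h])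
    (X : Matrix N N ℂ), ← hYX, h0]
  rfl

theorem iSupIndep_weightSummand (hg : IsIrreducibleGrading g β wt) (S : Set ℝ)
    (hS : ∀ ω ∈ S, 0 < ω) :
    iSupIndep fun ω : S => weightSummand g β wt hg.wt_eq_iff ω := by
  rw [← LieSubmodule.iSupIndep_toSubmodule]
  have h := Module.End.eigenspaces_iSupIndep (LieAlgebra.ad ℝ (compactForm g) hg.element ∘ₗ
    LieAlgebra.ad ℝ (compactForm g) hg.element)
  -- The summands lie in eigenspaces of ad(H)² with eigenvalues -ω², which are distinct because all
  -- ω are positive.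
  refine (h.comp (f := fun ω : S => -(ω : ℝ) ^ 2) ?_).mono ?_
  · intro a b hab
    refine Subtype.ext ?_
    rwa [neg_inj, sq_eq_sq₀ (hS a a.2).le (hS b b.2).le] at hab
  · intro ω X hX
    exact Module.End.mem_eigenspace_iff.2 (hg.lie_element_lie_element hX)

theorem iSup_weightSummand (hg : IsIrreducibleGrading g β wt) :
    ⨆ ω : positiveWeights g wt, weightSummand g β wt hg.wt_eq_iff ω = tangent g β := by
  refine le_antisymm (iSup_le fun ω => hg.weightSummand_le_tangent ω.2.1.ne') fun X hX => ?_
  choose Y hY hYX using fun c => hg.exists_component (tangent g β) hX c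
  have hsum : X = ∑ c ∈ Finset.univ.image (fun x : N × N => (wt x.1 - wt x.2) ^ 2), Y c := by
    refine Subtype.ext ?_
    rw [AddSubmonoidClass.coe_finsetSum]
    simp_rw [hYX]
    exact sum_mask (fun p q => (wt p - wt q) ^ 2) (X : Matrix N N ℂ)
  rw [hsum]
  refine sum_mem fun c _ => ?_
  by_cases hc : Y c = 0
  · rw [hc]; exact zero_mem _
  have : ∃ p q, (Y c : Matrix N N ℂ) p q ≠ 0 := by
    by_contra hne
    push Not at hne
    exact hc (Subtype.ext (Matrix.ext hne))
  obtain ⟨p, q, hpq⟩ := this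
  have hne : wt p - wt q ≠ 0 := fun h0 =>
    hpq (hg.apply_eq_zero_of_mem_tangent (hY c) (sub_eq_zero.1 h0))
  -- If wt p - wt q is negative, the conjugate transpose has a nonzero entry at (q, p), with the
  -- opposite difference.
  have hω : |wt p - wt q| ∈ positiveWeights g wt := by
    refine ⟨abs_pos.2 hne, ?_⟩
    rcases abs_choice (wt p - wt q) with h | h
    · exact ⟨p, q, ⟨Y c, (Y c).2.1, hpq⟩, h.symm⟩
    · refine ⟨q, p, ⟨_, hg.conjTranspose_mem _ (Y c).2.1, ?_⟩, by rw [h, neg_sub]⟩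
      rwa [Matrix.conjTranspose_apply, star_ne_zero]
  refine LieSubmodule.mem_iSup_of_mem (⟨_, hω⟩ : positiveWeights g wt) fun p' q' h' => ?_
  rw [hYX] at h' hpq
  rw [sq_abs, (of_mask_apply_ne_zero h').1, (of_mask_apply_ne_zero hpq).1]

end IsIrreducibleGrading

end Grading

/-! ### Irreducible submodules -/

section Irreducible

variable {R L M : Type*} [CommRing R] [LieRing L] [AddCommGroup M] [Module R M]
  [LieRingModule L M]

/-- With its converse below, this moves the question into the lattice of submodules, where
decompositions are compared. -/
theorem isIrreducible_of_isAtom {V : LieSubmodule R L M} (hV : IsAtom V) :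
    LieModule.IsIrreducible R L V := by
  have : Nontrivial V := (LieSubmodule.nontrivial_iff_ne_bot R L M).2 hV.1
  refine LieModule.IsIrreducible.mk fun W hW => ?_
  have hle : W.map V.incl ≤ V := by
    rintro _ ⟨x, -, rfl⟩
    exact x.2
  rcases hV.le_iff.1 hle with h | h
  · refine absurd ?_ hW
    rw [LieSubmodule.eq_bot_iff] at h ⊢
    exact fun x hx => Subtype.ext (h x ⟨x, hx, rfl⟩)
  · refine eq_top_iff.2 fun x _ => ?_
    obtain ⟨y, hy, hyx⟩ := h.ge x.2
    rwa [← Subtype.ext hyx]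

theorem isAtom_of_isIrreducible {V : LieSubmodule R L M} (hV : LieModule.IsIrreducible R L V) :
    IsAtom V := by
  refine ⟨(LieSubmodule.nontrivial_iff_ne_bot R L M).1 (LieModule.nontrivial_of_isIrreducible R L V),
    fun W hW => ?_⟩
  by_contra hne
  have h : W.comap V.incl = ⊤ := by
    refine (eq_bot_or_eq_top _).resolve_left fun h => hne ?_
    rw [LieSubmodule.eq_bot_iff] at h ⊢
    exact fun x hx => congrArg Subtype.val (h ⟨x, hW.le hx⟩ hx)
  refine hW.not_ge fun x hx => ?_
  have : (⟨x, hx⟩ : V) ∈ W.comap V.incl := h ▸ LieSubmodule.mem_top _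
  exact this

end Irreducible

/-- If the atoms below an element are exactly the members of an independent family, then every
decomposition of that element into atoms has as many terms as the family. -/
theorem card_eq_of_iSupIndep_of_isAtom {A ι κ : Type*} [CompleteLattice A] [Fintype ι] [Fintype κ]
    {V : ι → A} {W : κ → A} (hV : ∀ i, IsAtom (V i)) (hVi : iSupIndep V) (hW : ∀ j, IsAtom (W j))
    (hWi : iSupIndep W) (hsup : ⨆ i, V i = ⨆ j, W j)
    (hVW : ∀ a, IsAtom a → a ≤ ⨆ i, V i → ∃ i, a = V i) : Fintype.card κ = Fintype.card ι := by
  choose f hf using fun j => hVW (W j) (hW j) (hsup ▸ le_iSup W j)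
  refine Fintype.card_of_bijective (f := f) ⟨fun a b hab => ?_, fun i => ?_⟩
  · refine hWi.injective (fun j => (hW j).1) ?_
    rw [hf, hf, hab]
  -- If no W j equals V i, then all W j lie below the join of the other members of V. That join then
  -- contains V i, against independence.
  · by_contra hne
    push Not at hne
    refine (hV i).1 (disjoint_self.1 ((hVi i).mono_right ?_))
    calc V i ≤ ⨆ j, W j := hsup ▸ le_iSup V i
      _ ≤ _ := iSup_le fun j => hf j ▸ le_iSup₂_of_le (f j) (hne j) le_rfl

/-! ### Irreducibility of the weight summands and uniqueness of the decomposition. -/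

namespace IsIrreducibleGrading

variable {N B : Type} [Fintype N] [DecidableEq N] {g : LieSubalgebra ℂ (Matrix N N ℂ)} {β : N → B}
  {wt : N → ℝ}

/-- The components of an element of `g` lie in `g`. -/
theorem component_mem (hg : IsIrreducibleGrading g β wt) {X : Matrix N N ℂ} (hX : X ∈ g) (ω : ℝ) :
    mask (fun p q => wt p - wt q = ω) X ∈ g :=
  mask_mem_of_lie_gradingElement_mem wt g.toSubmodule
    (fun _ hX => g.lie_mem hg.gradingElement_mem hX) hX ω

omit [Fintype N] [DecidableEq N] in
/-- An element of `𝔲` of weight `± ω` is determined by its component of weight `ω`. -/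
theorem eq_sub_conjTranspose {ω : ℝ} (hω : 0 < ω) {X : Matrix N N ℂ}
    (hX : ∀ p q, X p q ≠ 0 → (wt p - wt q) ^ 2 = ω ^ 2) (hX' : X.conjTranspose = -X) :
    X = mask (fun p q => wt p - wt q = ω) X -
      (mask (fun p q => wt p - wt q = ω) X).conjTranspose := by
  ext p q
  have hs : star (X q p) = - X p q := by
    rw [← Matrix.conjTranspose_apply, hX', Matrix.neg_apply]
  rw [Matrix.sub_apply, Matrix.conjTranspose_apply]
  by_cases h0 : X p q = 0
  · have h1 : X q p = 0 := by rw [h0, neg_zero, star_eq_zero] at hs; exact hs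
    simp [mask, h0, h1]
  · rcases sq_eq_sq_iff_eq_or_eq_neg.1 (hX p q h0) with h | h
    · rw [mask_apply_of_pos (P := fun p q => wt p - wt q = ω) h,
        mask_apply_of_neg (P := fun p q => wt p - wt q = ω) (by linarith), star_zero, sub_zero]
    · rw [mask_apply_of_neg (P := fun p q => wt p - wt q = ω) (by linarith),
        mask_apply_of_pos (P := fun p q => wt p - wt q = ω) (by linarith), hs]
      ring

/-- The complex subspace of the elements `Y` of weight `ω` with `Y - Yᴴ ∈ W`. -/
def complexification (hg : IsIrreducibleGrading g β wt)
    (W : LieSubmodule ℝ (isotropy g β) (compactForm g)) {ω : ℝ} (hω : ω ≠ 0) :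
    Submodule ℂ (Matrix N N ℂ) where
  carrier := {Y | (Y ∈ g ∧ ∀ p q, Y p q ≠ 0 → wt p - wt q = ω) ∧
    ∃ X ∈ W, (X : Matrix N N ℂ) = Y - Y.conjTranspose}
  zero_mem' := ⟨⟨zero_mem g, fun _ _ h => absurd rfl h⟩, 0, zero_mem W, by simp⟩
  add_mem' := by
    rintro Y Y' ⟨⟨hY, hYw⟩, X, hX, hXY⟩ ⟨⟨hY', hYw'⟩, X', hX', hXY'⟩
    refine ⟨⟨add_mem hY hY', fun p q h => ?_⟩, X + X', add_mem hX hX', ?_⟩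
    · by_cases h0 : Y p q = 0
      · exact hYw' p q fun h1 => h (by rw [Matrix.add_apply, h0, h1, add_zero])
      · exact hYw p q h0
    · change (X : Matrix N N ℂ) + (X' : Matrix N N ℂ) = _
      rw [hXY, hXY', Matrix.conjTranspose_add]
      abel
  smul_mem' := by
    rintro c Y ⟨⟨hY, hYw⟩, X, hX, hXY⟩
    -- ad(H) acts by iω on Y and by -iω on Yᴴ, so [H, Y - Yᴴ] = ω(iY - (iY)ᴴ): on W, the operator
    -- ad(H)/ω plays the part of multiplication by i.
    refine ⟨⟨g.smul_mem c hY, fun p q h => hYw p q fun h0 => h ?_⟩, c.re • X + (c.im / ω) •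
      ⁅(⟨hg.element, hg.element_mem_isotropy⟩ : isotropy g β), X⁆,
      add_mem (W.smul_mem _ hX) (W.smul_mem _ (W.lie_mem hX)), ?_⟩
    · rw [Matrix.smul_apply, h0, smul_zero]
    · change c.re • (X : Matrix N N ℂ) + (c.im / ω) • ⁅gradingElement wt, (X : Matrix N N ℂ)⁆ = _
      rw [hXY]
      ext p q
      rw [Matrix.add_apply, Matrix.smul_apply, Matrix.smul_apply, lie_gradingElement_apply,
        Matrix.sub_apply, Matrix.sub_apply, Matrix.conjTranspose_apply, Matrix.conjTranspose_apply,
        Matrix.smul_apply, Matrix.smul_apply, Complex.real_smul, Complex.real_smul, smul_eq_mul,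
        smul_eq_mul, star_mul']
      have h1 : ((wt p - wt q : ℝ) : ℂ) * Y p q = ω * Y p q := by
        by_cases h0 : Y p q = 0
        · rw [h0, mul_zero, mul_zero]
        · rw [hYw p q h0]
      have h2 : ((wt p - wt q : ℝ) : ℂ) * star (Y q p) = - ω * star (Y q p) := by
        by_cases h0 : Y q p = 0
        · rw [h0, star_zero, mul_zero, mul_zero]
        · rw [← hYw q p h0]; push_cast; ring
      have h3 : ((c.im / ω : ℝ) : ℂ) * ω = c.im := by
        rw [← Complex.ofReal_mul, div_mul_cancel₀ _ hω]
      have h4 : c = c.re + c.im * Complex.I := (Complex.re_add_im c).symm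
      have h5 : star c = c.re - c.im * Complex.I := by
        apply Complex.ext <;> simp
      linear_combination ((c.im / ω : ℝ) : ℂ) * Complex.I * (h1 - h2) +
        Complex.I * (Y p q + star (Y q p)) * h3 - Y p q * h4 + star (Y q p) * h5

/-- For skew-Hermitian Z the map Y ↦ Y - Yᴴ commutes with the bracket by Z, so the claim follows
from 𝔨-invariance of W. General Z follows by complex linearity. -/
theorem lie_mem_complexification (hg : IsIrreducibleGrading g β wt)
    (W : LieSubmodule ℝ (isotropy g β) (compactForm g)) {ω : ℝ} (hω : ω ≠ 0)
    {Z Y : Matrix N N ℂ} (hZ : Z ∈ isotropyComplex g β) (hY : Y ∈ hg.complexification W hω) :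
    ⁅Z, Y⁆ ∈ hg.complexification W hω := by
  have key : ∀ Z ∈ isotropyComplex g β, Z.conjTranspose = -Z →
      ⁅Z, Y⁆ ∈ hg.complexification W hω := by
    intro Z hZ hZ'
    obtain ⟨⟨hYg, hYw⟩, X, hX, hXY⟩ := hY
    refine ⟨⟨g.lie_mem hZ.1 hYg, fun p q h => ?_⟩,
      ⁅(⟨⟨Z, hZ.1, hZ'⟩, hZ⟩ : isotropy g β), X⁆, W.lie_mem hX, ?_⟩
    · by_contra hne
      refine h ?_
      rw [Ring.lie_def, Matrix.sub_apply, Matrix.mul_apply, Matrix.mul_apply, Finset.sum_eq_zero,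
        Finset.sum_eq_zero, sub_zero]
      · intro l _
        by_cases hb : β l = β q
        · rw [show Y p l = 0 from ?_, zero_mul]
          by_contra h0
          exact hne ((hg.wt_eq_iff l q).2 hb ▸ hYw p l h0)
        · rw [hZ.2 l q hb, mul_zero]
      · intro l _
        by_cases hb : β p = β l
        · rw [show Y l q = 0 from ?_, mul_zero]
          by_contra h0
          exact hne ((hg.wt_eq_iff p l).2 hb ▸ hYw l q h0)
        · rw [hZ.2 p l hb, zero_mul]
    · change ⁅Z, (X : Matrix N N ℂ)⁆ = _
      rw [hXY, lie_sub, Ring.lie_def Z Y, Matrix.conjTranspose_sub, Matrix.conjTranspose_mul,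
        Matrix.conjTranspose_mul, hZ', Ring.lie_def]
      noncomm_ring
  obtain ⟨A, hA, C, hC, hA', hC', rfl⟩ := exists_skewHermitian_decomposition
    (conjTranspose_mem_isotropyComplex hg.conjTranspose_mem) hZ
  rw [add_lie, smul_lie]
  exact add_mem (key A hA hA') (Submodule.smul_mem _ _ (key C hC hC'))

/-- A nonzero submodule W has a nonzero complexification, which by irreducibility contains every
element of `g` of weight ω. Since Y ↦ Y - Yᴴ is onto the summand, W is the whole of it. -/
theorem isAtom_weightSummand (hg : IsIrreducibleGrading g β wt) {ω : ℝ}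
    (hω : ω ∈ positiveWeights g wt) : IsAtom (weightSummand g β wt hg.wt_eq_iff ω) := by
  obtain ⟨hpos, p, q, ⟨X, hX, hXpq⟩, hpq⟩ := hω
  constructor
  · rw [Ne, LieSubmodule.eq_bot_iff]
    intro h
    set Y := mask (fun p q => wt p - wt q = ω) X with hYdef
    have hY : Y ∈ g := hg.component_mem hX ω
    have hY0 : Y p q = X p q := mask_apply_of_pos (P := fun p q => wt p - wt q = ω) hpq X
    -- The position (q, p) has difference -ω, so Y and Yᴴ cannot cancel at (p, q).
    have hY1 : Y q p = 0 := mask_apply_of_neg (P := fun p q => wt p - wt q = ω) (by linarith) X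
    have := h ⟨Y - Y.conjTranspose, sub_mem hY (hg.conjTranspose_mem _ hY), by
      rw [Matrix.conjTranspose_sub, Matrix.conjTranspose_conjTranspose, neg_sub]⟩ ?_
    · have h2 := congr_fun (congr_fun (congrArg Subtype.val this) p) q
      change (Y - Y.conjTranspose) p q = 0 at h2
      rw [Matrix.sub_apply, Matrix.conjTranspose_apply, hY0, hY1, star_zero, sub_zero] at h2
      exact hXpq h2
    · intro p' q' h'
      change (Y - Y.conjTranspose) p' q' ≠ 0 at h'
      by_cases h0 : Y p' q' = 0
      · rw [Matrix.sub_apply, h0, zero_sub, neg_ne_zero, Matrix.conjTranspose_apply,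
          star_ne_zero] at h'
        rw [← (of_mask_apply_ne_zero h').1]
        ring
      · rw [(of_mask_apply_ne_zero h0).1]
  · intro W hW
    by_contra hne
    refine hW.not_ge fun X hX => ?_
    have hmem : ∀ Y ∈ g, (∀ p q, Y p q ≠ 0 → wt p - wt q = ω) →
        Y ∈ hg.complexification W hpos.ne' := by
      refine hg.irreducible ω hpos _ (fun X hX => hX.1)
        (fun Z hZ X hX => hg.lie_mem_complexification W _ hZ hX) fun hbot => hne ?_
      rw [LieSubmodule.eq_bot_iff]
      intro X hX
      have hdec := eq_sub_conjTranspose hpos (hW.le hX) X.2.2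
      have : mask (fun p q => wt p - wt q = ω) (X : Matrix N N ℂ) ∈
          hg.complexification W hpos.ne' :=
        ⟨⟨hg.component_mem X.2.1 ω, fun p q h => (of_mask_apply_ne_zero h).1⟩, X, hX, hdec⟩
      rw [hbot, Submodule.mem_bot] at this
      rw [this, Matrix.conjTranspose_zero, sub_zero] at hdec
      exact Subtype.ext hdec
    obtain ⟨-, X', hX', h⟩ := hmem _ (hg.component_mem X.2.1 ω)
      (fun p q h => (of_mask_apply_ne_zero h).1)
    rw [← eq_sub_conjTranspose hpos hX X.2.2] at h
    rwa [← Subtype.ext h]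

/-- A nonzero component of an element of W lies in W and in one weight summand. Two atoms with
nonzero meet coincide. -/
theorem exists_eq_weightSummand (hg : IsIrreducibleGrading g β wt)
    {W : LieSubmodule ℝ (isotropy g β) (compactForm g)} (hW : IsAtom W) (hWt : W ≤ tangent g β) :
    ∃ ω : positiveWeights g wt, W = weightSummand g β wt hg.wt_eq_iff ω := by
  obtain ⟨X, hX, hX0⟩ := (Submodule.ne_bot_iff _).1
    (fun h => hW.1 ((LieSubmodule.toSubmodule_eq_bot W).1 h))
  have : ∃ p q, (X : Matrix N N ℂ) p q ≠ 0 := by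
    by_contra hne
    push Not at hne
    exact hX0 (Subtype.ext (Matrix.ext hne))
  obtain ⟨p, q, hpq⟩ := this
  have hne : wt p - wt q ≠ 0 := fun h0 =>
    hpq (hg.apply_eq_zero_of_mem_tangent (hWt hX) (sub_eq_zero.1 h0))
  have hω : |wt p - wt q| ∈ positiveWeights g wt := by
    refine ⟨abs_pos.2 hne, ?_⟩
    rcases abs_choice (wt p - wt q) with h | h
    · exact ⟨p, q, ⟨X, X.2.1, hpq⟩, h.symm⟩
    · refine ⟨q, p, ⟨_, hg.conjTranspose_mem _ X.2.1, ?_⟩, by rw [h, neg_sub]⟩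
      rwa [Matrix.conjTranspose_apply, star_ne_zero]
  refine ⟨⟨_, hω⟩, ?_⟩
  obtain ⟨Y, hY, hYX⟩ := hg.exists_component W hX ((wt p - wt q) ^ 2)
  have hYV : Y ∈ weightSummand g β wt hg.wt_eq_iff |wt p - wt q| := fun p' q' h => by
    rw [hYX] at h
    rw [sq_abs, (of_mask_apply_ne_zero h).1]
  have hY0 : Y ≠ 0 := by
    rintro rfl
    refine hpq ?_
    rw [← mask_apply_of_pos (P := fun i j => (wt i - wt j) ^ 2 = (wt p - wt q) ^ 2) rfl
      (X : Matrix N N ℂ), ← hYX]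
    rfl
  have hle : W ⊓ weightSummand g β wt hg.wt_eq_iff |wt p - wt q| ≠ ⊥ := fun h =>
    hY0 ((LieSubmodule.eq_bot_iff _).1 h Y ⟨hY, hYV⟩)
  have h1 := (hW.le_iff.1 inf_le_left).resolve_left hle
  have h2 := ((hg.isAtom_weightSummand hω).le_iff.1 inf_le_right).resolve_left hle
  exact h1.symm.trans h2

theorem hasIsotropySummands (hg : IsIrreducibleGrading g β wt) {k : ℕ}
    (hk : (positiveWeights g wt).encard = k) : HasIsotropySummands g β k := by
  have hfin := positiveWeights_finite g wt
  let _ : Fintype (positiveWeights g wt) := hfin.fintype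
  have hcard : Fintype.card (positiveWeights g wt) = k := by
    rw [← Nat.card_eq_fintype_card, Nat.card_coe_set_eq, Set.ncard, hk, ENat.toNat_natCast]
  have hind := hg.iSupIndep_weightSummand (positiveWeights g wt) fun _ h => h.1
  constructor
  · let e : Fin k ≃ positiveWeights g wt := (Fintype.equivFinOfCardEq hcard).symm
    refine ⟨fun i => weightSummand g β wt hg.wt_eq_iff (e i),
      fun i => isIrreducible_of_isAtom (hg.isAtom_weightSummand (e i).2),
      hind.comp e.injective, ?_⟩
    rw [← hg.iSup_weightSummand]
    exact e.iSup_comp (g := fun ω : positiveWeights g wt => weightSummand g β wt hg.wt_eq_iff ω)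
  · rintro l W ⟨hirr, hWi, hsup⟩
    rw [← hcard, ← Fintype.card_fin l]
    refine card_eq_of_iSupIndep_of_isAtom
      (fun ω : positiveWeights g wt => hg.isAtom_weightSummand ω.2) hind
      (fun i => isAtom_of_isIrreducible (hirr i)) hWi (hg.iSup_weightSummand.trans hsup.symm) ?_
    intro a ha hle
    exact hg.exists_eq_weightSummand ha (hg.iSup_weightSummand ▸ hle)

end IsIrreducibleGrading

/-! ### Root vectors and positive t-roots -/

section RootVectors

variable {N B : Type} [Fintype N] [DecidableEq N] {g : LieSubalgebra ℂ (Matrix N N ℂ)} {β : N → B}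
  {wt : N → ℝ}

theorem gradingElement_mem_isotropyComplex {μ : N → ℝ} (hμ : gradingElement μ ∈ g) :
    gradingElement μ ∈ isotropyComplex g β :=
  ⟨hμ, fun _ _ h => Matrix.diagonal_apply_ne _ fun h' => h (congrArg β h')⟩

/-- A graded piece is irreducible if the root spaces are spanned by root vectors, and if each
invariant subspace containing one of the root vectors of the piece contains the others. -/
theorem mem_of_rootVectors (E : N → N → Matrix N N ℂ) (μ : N → ℝ) (hμ : gradingElement μ ∈ g)
    (hspan : ∀ p q, p ≠ q → ∀ X ∈ g, (∀ i j, X i j ≠ 0 → μ i - μ j = μ p - μ q) →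
      ∃ c : ℂ, X = c • E p q) {ω : ℝ} (hω : 0 < ω) {W : Submodule ℂ (Matrix N N ℂ)}
    (hWg : ∀ X ∈ W, X ∈ g ∧ ∀ p q, X p q ≠ 0 → wt p - wt q = ω)
    (hinv : ∀ Z ∈ isotropyComplex g β, ∀ X ∈ W, ⁅Z, X⁆ ∈ W) (hW : W ≠ ⊥)
    (hconn : ∀ p q p' q', wt p - wt q = ω → wt p' - wt q' = ω →
      (∃ X ∈ g, X p q ≠ 0) → (∃ X ∈ g, X p' q' ≠ 0) → E p q ∈ W → E p' q' ∈ W)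
    {X : Matrix N N ℂ} (hX : X ∈ g) (hXω : ∀ p q, X p q ≠ 0 → wt p - wt q = ω) : X ∈ W := by
  have hμ' : gradingElement μ ∈ isotropyComplex g β := gradingElement_mem_isotropyComplex hμ
  -- The component of Y for the regular weights at a nonzero entry (p, q) lies in one root space, so
  -- it is a nonzero multiple of E p q.
  have hcomp : ∀ Y ∈ g, (∀ p q, Y p q ≠ 0 → wt p - wt q = ω) → ∀ p q, Y p q ≠ 0 →
      ∃ c : ℂ, c ≠ 0 ∧ mask (fun i j => μ i - μ j = μ p - μ q) Y = c • E p q := by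
    intro Y hY hYω p q hpq
    have hne : p ≠ q := by
      rintro rfl
      have := hYω p p hpq
      rw [sub_self] at this
      exact hω.ne this
    obtain ⟨c, hc⟩ := hspan p q hne _ (mask_mem_of_lie_gradingElement_mem μ g.toSubmodule
      (fun _ hX => g.lie_mem hμ hX) hY (μ p - μ q)) (fun i j h => (of_mask_apply_ne_zero h).1)
    refine ⟨c, ?_, hc⟩
    rintro rfl
    refine hpq ?_
    rw [← mask_apply_of_pos (P := fun i j => μ i - μ j = μ p - μ q) rfl Y, hc, zero_smul,
      Matrix.zero_apply]
  obtain ⟨Y, hY, hY0⟩ := (Submodule.ne_bot_iff _).1 hW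
  have : ∃ p q, Y p q ≠ 0 := by
    by_contra hne
    push Not at hne
    exact hY0 (Matrix.ext hne)
  obtain ⟨p₀, q₀, h₀⟩ := this
  obtain ⟨hYg, hYω⟩ := hWg Y hY
  have hE : E p₀ q₀ ∈ W := by
    obtain ⟨c, hc, h⟩ := hcomp Y hYg hYω p₀ q₀ h₀
    rw [← W.smul_mem_iff hc, ← h]
    exact mask_mem_of_lie_gradingElement_mem μ W (hinv _ hμ') hY _
  -- X is the sum of its root components, each a multiple of a root vector reachable from the one
  -- found in W.
  rw [sum_mask (fun p q => μ p - μ q) X]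
  refine sum_mem fun c _ => ?_
  by_cases hc : mask (fun p q => μ p - μ q = c) X = 0
  · rw [hc]; exact zero_mem _
  have : ∃ p q, mask (fun p q => μ p - μ q = c) X p q ≠ 0 := by
    by_contra hne
    push Not at hne
    exact hc (Matrix.ext hne)
  obtain ⟨p, q, hpq⟩ := this
  obtain ⟨rfl, hXpq⟩ := of_mask_apply_ne_zero hpq
  obtain ⟨c, -, h⟩ := hcomp X hX hXω p q hXpq
  rw [h]
  exact W.smul_mem c (hconn p₀ q₀ p q (hYω _ _ h₀) (hXω _ _ hXpq) ⟨Y, hYg, h₀⟩ ⟨X, hX, hXpq⟩ hE)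

/-- The grading element lies in the Cartan subalgebra. -/
theorem gradingElement_mem_cartan {μ : N → ℝ} (hμ : gradingElement μ ∈ g) :
    gradingElement μ ∈ cartan g := ⟨hμ, Matrix.isDiag_diagonal _⟩

theorem coord_sub_coord_gradingElement {μ : N → ℝ} (hμ : gradingElement μ ∈ g) (p q : N) :
    (coord g p - coord g q) ⟨gradingElement μ, gradingElement_mem_cartan hμ⟩ =
      Complex.I * ((μ p - μ q : ℝ) : ℂ) := by
  change gradingElement μ p p - gradingElement μ q q = _
  rw [gradingElement, Matrix.diagonal_apply_eq, Matrix.diagonal_apply_eq]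
  push_cast
  ring

namespace IsIrreducibleGrading

theorem gradingElement_mem_tSpace (hg : IsIrreducibleGrading g β wt) :
    gradingElement wt ∈ tSpace g β := by
  refine ⟨gradingElement_mem_cartan hg.gradingElement_mem,
    ⟨hg.gradingElement_mem, conjTranspose_gradingElement wt⟩, fun X hX => ?_⟩
  ext p q
  rw [lie_gradingElement_apply]
  by_cases h : β p = β q
  · rw [(hg.wt_eq_iff p q).2 h, sub_self]
    simp
  · rw [hX.2 p q h, mul_zero, Matrix.zero_apply]

/-- A root is the difference of the coordinates at any nonzero entry of its root vector, and its
value at H is i times the weight difference. The root belongs to 𝔨^ℂ exactly when this difference is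
0. By `hpos` and `hpos'`, the positive system is compatible with the sign of the difference. -/
theorem mem_positiveTRoots_iff (hg : IsIrreducibleGrading g β wt)
    {pos : Set (Module.Dual ℂ (cartan g))}
    (hroot : ∀ p q, p ≠ q → (∃ X ∈ g, X p q ≠ 0) →
      ∃ E ∈ g, E p q ≠ 0 ∧ ∀ H ∈ cartan g, ⁅H, E⁆ = (H p p - H q q) • E)
    (hpos : ∀ p q, (∃ X ∈ g, X p q ≠ 0) → wt q < wt p → coord g p - coord g q ∈ pos)
    (hpos' : ∀ α ∈ pos,
      0 ≤ (α ⟨gradingElement wt, gradingElement_mem_cartan hg.gradingElement_mem⟩).im)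
    (f : tSpace g β →ₗ[ℝ] ℂ) :
    f ∈ positiveTRoots g β pos ↔ ∃ p q, (∃ X ∈ g, X p q ≠ 0) ∧ wt q < wt p ∧
      f = restrictT g β (coord g p - coord g q) := by
  have hentry : ∀ (α : Module.Dual ℂ (cartan g)) (X : Matrix N N ℂ),
      (∀ H : cartan g, ⁅(H : Matrix N N ℂ), X⁆ = α H • X) → ∀ p q, X p q ≠ 0 →
      α = coord g p - coord g q := by
    intro α X hX p q hpq
    ext H
    have := congr_fun (congr_fun (hX H) p) q
    rw [lie_isDiag_apply H.2.2, Matrix.smul_apply, smul_eq_mul] at this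
    exact (mul_right_cancel₀ hpq this).symm
  have hexists : ∀ X : Matrix N N ℂ, X ≠ 0 → ∃ p q, X p q ≠ 0 := by
    intro X hX
    by_contra hne
    push Not at hne
    exact hX (Matrix.ext hne)
  have hwt : ∀ p q p' q', coord g p - coord g q = coord g p' - coord g q' →
      wt p - wt q = wt p' - wt q' := by
    intro p q p' q' h
    have := LinearMap.congr_fun h ⟨gradingElement wt,
      gradingElement_mem_cartan hg.gradingElement_mem⟩
    rw [coord_sub_coord_gradingElement hg.gradingElement_mem,
      coord_sub_coord_gradingElement hg.gradingElement_mem,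
      mul_right_inj' Complex.I_ne_zero, Complex.ofReal_inj] at this
    exact this
  constructor
  · rintro ⟨α, ⟨⟨⟨hα, X, hX, hX0, hXα⟩, hαk⟩, hαpos⟩, rfl⟩
    obtain ⟨p, q, hpq⟩ := hexists X hX0
    obtain rfl := hentry α X hXα p q hpq
    refine ⟨p, q, ⟨X, hX, hpq⟩, ?_, rfl⟩
    have h1 := hpos' _ hαpos
    rw [coord_sub_coord_gradingElement hg.gradingElement_mem, Complex.im_mul_ofReal, Complex.I_im,
      one_mul] at h1
    -- If the difference were 0, every nonzero entry of X would join rows of one block, making the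
    -- root a root of 𝔨^ℂ.
    refine lt_of_le_of_ne (sub_nonneg.1 h1) fun heq => hαk ⟨hα, X, ⟨hX, fun i j hij => ?_⟩, hX0, hXα⟩
    by_contra h0
    refine hij ((hg.wt_eq_iff i j).1 ?_)
    have := hwt _ _ _ _ (hentry _ X hXα i j h0)
    linarith
  · rintro ⟨p, q, hocc, hlt, rfl⟩
    have hne : p ≠ q := by
      rintro rfl
      exact lt_irrefl _ hlt
    obtain ⟨E, hE, hE0, hEα⟩ := hroot p q hne hocc
    refine ⟨_, ⟨⟨⟨?_, E, hE, ?_, fun H => hEα H H.2⟩, ?_⟩, hpos p q hocc hlt⟩, rfl⟩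
    · intro h
      have := hwt p q p p (by rw [h, sub_self])
      linarith
    · rintro rfl
      exact hE0 rfl
    · rintro ⟨-, Y, hY, hY0, hYα⟩
      obtain ⟨i, j, hij⟩ := hexists Y hY0
      have h1 := hwt _ _ _ _ (hentry _ Y hYα i j hij)
      have h2 : β i = β j := by
        by_contra h
        exact hij (hY.2 i j h)
      rw [← hg.wt_eq_iff] at h2
      linarith

/-- Evaluation at H ∈ 𝔱, followed by the imaginary part, is the bijection. Its injectivity is
`hdiff`: a weight difference determines the restriction to 𝔱. -/
theorem encard_positiveTRoots (hg : IsIrreducibleGrading g β wt)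
    {pos : Set (Module.Dual ℂ (cartan g))}
    (hroot : ∀ p q, p ≠ q → (∃ X ∈ g, X p q ≠ 0) →
      ∃ E ∈ g, E p q ≠ 0 ∧ ∀ H ∈ cartan g, ⁅H, E⁆ = (H p p - H q q) • E)
    (hpos : ∀ p q, (∃ X ∈ g, X p q ≠ 0) → wt q < wt p → coord g p - coord g q ∈ pos)
    (hpos' : ∀ α ∈ pos,
      0 ≤ (α ⟨gradingElement wt, gradingElement_mem_cartan hg.gradingElement_mem⟩).im)
    (hdiff : ∀ p q p' q', wt q < wt p → wt p - wt q = wt p' - wt q' →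
      ∀ H ∈ tSpace g β, H p p - H q q = H p' p' - H q' q') :
    (positiveTRoots g β pos).encard = (positiveWeights g wt).encard := by
  have hiff := hg.mem_positiveTRoots_iff hroot hpos hpos'
  let H₀ : tSpace g β := ⟨gradingElement wt, hg.gradingElement_mem_tSpace⟩
  have hval : ∀ p q, restrictT g β (coord g p - coord g q) H₀ =
      Complex.I * ((wt p - wt q : ℝ) : ℂ) := fun p q =>
    coord_sub_coord_gradingElement hg.gradingElement_mem p q
  have hval' : ∀ p q, (restrictT g β (coord g p - coord g q) H₀).im = wt p - wt q := by
    intro p q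
    rw [hval, Complex.im_mul_ofReal, Complex.I_im, one_mul]
  have hinj : Set.InjOn (fun f : tSpace g β →ₗ[ℝ] ℂ => (f H₀).im) (positiveTRoots g β pos) := by
    intro f hf f' hf' h
    obtain ⟨p, q, -, hlt, rfl⟩ := (hiff f).1 hf
    obtain ⟨p', q', -, -, rfl⟩ := (hiff f').1 hf'
    ext H
    refine hdiff p q p' q' hlt ?_ H H.2
    simpa only [hval'] using h
  rw [← hinj.encard_image]
  congr 1
  ext ω
  constructor
  · rintro ⟨f, hf, rfl⟩
    obtain ⟨p, q, hocc, hlt, rfl⟩ := (hiff f).1 hf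
    exact ⟨by simpa only [hval', sub_pos] using hlt, p, q, hocc, (hval' p q).symm⟩
  · rintro ⟨hω, p, q, hocc, rfl⟩
    exact ⟨_, (hiff _).2 ⟨p, q, hocc, sub_pos.1 hω, rfl⟩, hval' p q⟩

end IsIrreducibleGrading

end RootVectors

/-! ### Generic weights -/

section GenericWeights

/-- The real numbers `0` and `± 5 ^ k`. -/
def IsSignedPower (x : ℝ) : Prop := x = 0 ∨ ∃ k : ℕ, x = 5 ^ k ∨ x = -5 ^ k

theorem IsSignedPower.neg {x : ℝ} (hx : IsSignedPower x) : IsSignedPower (-x) := by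
  rcases hx with rfl | ⟨k, rfl | rfl⟩
  · exact Or.inl neg_zero
  · exact Or.inr ⟨k, Or.inr rfl⟩
  · exact Or.inr ⟨k, Or.inl (neg_neg _)⟩

theorem isSignedPower_pow (k : ℕ) : IsSignedPower (5 ^ k) := Or.inr ⟨k, Or.inl rfl⟩

theorem isSignedPower_zero : IsSignedPower 0 := Or.inl rfl

/-- Distinct powers of 5 differ by a factor of at least 5. -/
theorem IsSignedPower.eq_neg_or_le {x y : ℝ} (hx : IsSignedPower x) (hy : IsSignedPower y)
    (h0 : 0 < x) (h : |y| ≤ x) : y = -x ∨ -x ≤ 5 * y := by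
  rcases hy with rfl | ⟨k, rfl | rfl⟩
  · right; linarith
  · right; have : (0 : ℝ) < 5 ^ k := by positivity
    linarith
  · rcases hx with rfl | ⟨m, rfl | rfl⟩
    · exact absurd h0 (lt_irrefl 0)
    · rw [abs_neg, abs_of_pos (by positivity), pow_le_pow_iff_right₀ (by norm_num)] at h
      rcases h.eq_or_lt with rfl | hlt
      · exact Or.inl rfl
      · right
        have : (5 : ℝ) ^ (k + 1) ≤ 5 ^ m := pow_le_pow_right₀ (by norm_num) hlt
        rw [pow_succ] at this
        linarith
    · have : (0 : ℝ) < 5 ^ m := by positivity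
      linarith

/-- Take x > 0. If none of the other three is -x, each is at least -x/5, so the sum is at least
2x/5. Any base above 3 would do. -/
theorem cancel_of_abs_le {x y z w : ℝ} (hx : IsSignedPower x) (hy : IsSignedPower y)
    (hz : IsSignedPower z) (hw : IsSignedPower w) (hxy : |y| ≤ |x|) (hxz : |z| ≤ |x|)
    (hxw : |w| ≤ |x|) (h : x + y + z + w = 0) : x = -y ∨ x = -z ∨ x = -w := by
  wlog h0 : 0 < x generalizing x y z w
  · rcases (not_lt.1 h0).eq_or_lt with rfl | hneg
    · rw [abs_zero, abs_nonpos_iff] at hxy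
      simp [hxy]
    · have := this hx.neg hy.neg hz.neg hw.neg (by simpa using hxy) (by simpa using hxz)
        (by simpa using hxw) (by linarith) (by linarith)
      simpa only [neg_inj] using this
  rw [abs_of_pos h0] at hxy hxz hxw
  rcases hx.eq_neg_or_le hy h0 hxy with rfl | h1
  · simp
  rcases hx.eq_neg_or_le hz h0 hxz with rfl | h2
  · simp
  rcases hx.eq_neg_or_le hw h0 hxw with rfl | h3
  · simp
  linarith

/-- A sum of two signed powers determines them, unless it vanishes. -/
theorem IsSignedPower.eq_of_add_eq_add {x y z w : ℝ} (hx : IsSignedPower x) (hy : IsSignedPower y)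
    (hz : IsSignedPower z) (hw : IsSignedPower w) (h : x + y = z + w) (h0 : x + y ≠ 0) :
    (x = z ∧ y = w) ∨ (x = w ∧ y = z) := by
  -- The numbers x, y, -z, -w sum to 0, so whichever has the largest absolute value cancels against
  -- another one.
  have hcancel : x = -y ∨ x = z ∨ x = w ∨ y = z ∨ y = w ∨ z = -w := by
    rcases le_total |x| |y| with h1 | h1 <;> rcases le_total |z| |w| with h2 | h2
    · rcases le_total |y| |w| with h3 | h3
      · have := cancel_of_abs_le hw.neg hx hy hz.neg (by simpa using h1.trans h3) (by simpa)
          (by simpa) (by linarith)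
        grind
      · have := cancel_of_abs_le hy hx hz.neg hw.neg (by simpa) (by simpa using h2.trans h3)
          (by simpa) (by linarith)
        grind
    · rcases le_total |y| |z| with h3 | h3
      · have := cancel_of_abs_le hz.neg hx hy hw.neg (by simpa using h1.trans h3) (by simpa)
          (by simpa) (by linarith)
        grind
      · have := cancel_of_abs_le hy hx hz.neg hw.neg (by simpa) (by simpa)
          (by simpa using h2.trans h3) (by linarith)
        grind
    · rcases le_total |x| |w| with h3 | h3
      · have := cancel_of_abs_le hw.neg hx hy hz.neg (by simpa) (by simpa using h1.trans h3)
          (by simpa) (by linarith)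
        grind
      · have := cancel_of_abs_le hx hy hz.neg hw.neg (by simpa) (by simpa using h2.trans h3)
          (by simpa) (by linarith)
        grind
    · rcases le_total |x| |z| with h3 | h3
      · have := cancel_of_abs_le hz.neg hx hy hw.neg (by simpa) (by simpa using h1.trans h3)
          (by simpa) (by linarith)
        grind
      · have := cancel_of_abs_le hx hy hz.neg hw.neg (by simpa) (by simpa)
          (by simpa using h2.trans h3) (by linarith)
        grind
  rcases hcancel with h1 | h1 | h1 | h1 | h1 | h1
  · exact absurd (by linarith) h0
  · exact Or.inl ⟨h1, by linarith⟩
  · exact Or.inr ⟨h1, by linarith⟩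
  · exact Or.inr ⟨by linarith, h1⟩
  · exact Or.inl ⟨by linarith, h1⟩
  · exact absurd (by linarith) h0

/-- The weight of the `i`-th unitary factor. -/
def factorWeight {r : ℕ} (i : Fin r) : ℝ := 5 ^ (r - (i : ℕ))

variable {r : ℕ}

theorem factorWeight_pos (i : Fin r) : 0 < factorWeight i := by
  unfold factorWeight
  positivity

/-- Weights decrease along the blocks, so the standard positive roots have nonnegative weight
difference. -/
theorem factorWeight_lt_iff {i j : Fin r} : factorWeight i < factorWeight j ↔ j < i := by
  unfold factorWeight
  rw [pow_lt_pow_iff_right₀ (by norm_num), Fin.lt_def]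
  have := i.2
  omega

theorem factorWeight_injective : Function.Injective (factorWeight (r := r)) := by
  intro i j h
  refine le_antisymm (not_lt.1 fun hlt => ?_) (not_lt.1 fun hlt => ?_)
  · exact (factorWeight_lt_iff.2 hlt).ne h
  · exact (factorWeight_lt_iff.2 hlt).ne h.symm

theorem isSignedPower_factorWeight (i : Fin r) : IsSignedPower (factorWeight i) :=
  isSignedPower_pow _

/-- Differences of positive powers of five determine them. -/
theorem eq_of_pow_sub_pow_eq {a b c e : ℝ} (ha : IsSignedPower a) (hb : IsSignedPower b)
    (hc : IsSignedPower c) (he : IsSignedPower e) (hb0 : 0 < b) (hc0 : 0 < c)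
    (h : a - b = c - e) (h0 : a ≠ b) : a = c ∧ b = e := by
  rcases ha.eq_of_add_eq_add hb.neg hc he.neg (by linarith) (by
    rw [← sub_eq_add_neg]; exact sub_ne_zero.2 h0) with ⟨h1, h2⟩ | ⟨h1, h2⟩
  · exact ⟨h1, neg_inj.1 h2⟩
  · linarith

end GenericWeights

/-! ### Type A -/

section TypeA

variable {r : ℕ} (d : Fin r → ℕ)

theorem mem_gA {X : Matrix (UIndex d) (UIndex d) ℂ} : X ∈ gA d ↔ X.trace = 0 := Iff.rfl

/-- The function `v`, made traceless. -/
def centered (v : UIndex d → ℝ) (p : UIndex d) : ℝ := v p - (∑ q, v q) / Fintype.card (UIndex d)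

theorem centered_sub_centered (v : UIndex d → ℝ) (p q : UIndex d) :
    centered d v p - centered d v q = v p - v q := by
  unfold centered
  ring

theorem gradingElement_centered_mem (v : UIndex d → ℝ) : gradingElement (centered d v) ∈ gA d := by
  rw [mem_gA, gradingElement, Matrix.trace_diagonal, ← Finset.mul_sum, ← Complex.ofReal_sum]
  rcases isEmpty_or_nonempty (UIndex d) with h | h
  · simp
  · have : (Fintype.card (UIndex d) : ℝ) ≠ 0 :=
      Nat.cast_ne_zero.2 Fintype.card_ne_zero
    simp only [centered]
    rw [Finset.sum_sub_distrib, Finset.sum_const, Finset.card_univ, nsmul_eq_mul,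
      mul_div_cancel₀ _ this, sub_self, Complex.ofReal_zero, mul_zero]

theorem single_mem_gA {p q : UIndex d} (h : p ≠ q) : Matrix.single p q (1 : ℂ) ∈ gA d :=
  (mem_gA d).2 (Matrix.trace_single_eq_of_ne p q 1 h)

theorem single_mem_isotropyComplex_gA {p q : UIndex d} (h : p ≠ q) (hb : p.1 = q.1) :
    Matrix.single p q (1 : ℂ) ∈ isotropyComplex (gA d) (blockA d) :=
  ⟨single_mem_gA d h, fun i j hij => Matrix.single_apply_of_ne _ _ _ _ _ fun hpq =>
    hij (by rw [← hpq.1, ← hpq.2]; exact hb)⟩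

/-- The weights of the block decomposition in type A. -/
def weightA : UIndex d → ℝ := centered d fun p => factorWeight p.1

/-- Weights separating the roots in type A. -/
def regularA : UIndex d → ℝ := centered d fun p => 5 ^ (Fintype.equivFin (UIndex d) p : ℕ)

theorem weightA_sub (p q : UIndex d) :
    weightA d p - weightA d q = factorWeight p.1 - factorWeight q.1 :=
  centered_sub_centered d _ p q

theorem eq_of_weightA_sub_eq {p q p' q' : UIndex d}
    (h : weightA d p - weightA d q = weightA d p' - weightA d q') (h0 : weightA d p ≠ weightA d q) :
    p.1 = p'.1 ∧ q.1 = q'.1 := by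
  rw [← sub_ne_zero, weightA_sub, sub_ne_zero] at h0
  rw [weightA_sub, weightA_sub] at h
  have := eq_of_pow_sub_pow_eq (isSignedPower_factorWeight _) (isSignedPower_factorWeight _)
    (isSignedPower_factorWeight _) (isSignedPower_factorWeight _) (factorWeight_pos _)
    (factorWeight_pos _) h h0
  exact ⟨factorWeight_injective this.1, factorWeight_injective this.2⟩

theorem five_pow_injective {α : Type*} [Fintype α] :
    Function.Injective fun p : α => (5 : ℝ) ^ (Fintype.equivFin α p : ℕ) := fun _ _ h =>
  (Fintype.equivFin α).injective (Fin.ext (pow_right_injective₀ (by norm_num) (by norm_num) h))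

theorem eq_of_regularA_sub_eq {p q p' q' : UIndex d}
    (h : regularA d p - regularA d q = regularA d p' - regularA d q') (h0 : p ≠ q) :
    p = p' ∧ q = q' := by
  rw [regularA, centered_sub_centered, centered_sub_centered] at h
  have := eq_of_pow_sub_pow_eq (isSignedPower_pow _) (isSignedPower_pow _)
    (isSignedPower_pow _) (isSignedPower_pow _) (by positivity) (by positivity) h
    (five_pow_injective.ne h0)
  exact ⟨five_pow_injective this.1, five_pow_injective this.2⟩

theorem isIrreducibleGradingA : IsIrreducibleGrading (gA d) (blockA d) (weightA d) where
  conjTranspose_mem := fun X hX => by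
    rw [mem_gA] at hX ⊢
    rw [Matrix.trace_conjTranspose, hX, star_zero]
  gradingElement_mem := gradingElement_centered_mem d _
  wt_eq_iff := fun p q => by
    rw [← sub_eq_zero, weightA_sub, sub_eq_zero, factorWeight_injective.eq_iff]
    rfl
  eq_zero_of_lie_eq_zero := fun X hX hcomm => by
    -- Commuting with a regular diagonal matrix makes X diagonal; commuting with matrix units then
    -- makes it scalar, and trace zero makes it vanish.
    have hdiag : ∀ p q, p ≠ q → X p q = 0 := by
      intro p q hpq
      have h := hcomm _ (gradingElement_centered_mem d
        fun p => 5 ^ (Fintype.equivFin (UIndex d) p : ℕ))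
      rw [← lie_skew, neg_eq_zero] at h
      have h := congr_fun (congr_fun h p) q
      rw [lie_gradingElement_apply, centered_sub_centered, Matrix.zero_apply] at h
      refine (mul_eq_zero.1 h).resolve_left (mul_ne_zero Complex.I_ne_zero ?_)
      exact Complex.ofReal_ne_zero.2 (sub_ne_zero.2 (five_pow_injective.ne hpq))
    have hXd : X.IsDiag := fun p q hpq => hdiag p q hpq
    have hconst : ∀ p q, X p p = X q q := by
      intro p q
      by_cases hpq : p = q
      · rw [hpq]
      · have h := congr_fun (congr_fun (hcomm _ (single_mem_gA d hpq)) p) q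
        rw [lie_isDiag_apply hXd, Matrix.single_apply_same, mul_one, Matrix.zero_apply] at h
        exact sub_eq_zero.1 h
    ext p q
    by_cases hpq : p = q
    · subst hpq
      have htr : X.trace = Fintype.card (UIndex d) * X p p := by
        have hq : ∀ q ∈ Finset.univ, X.diag q = X p p := fun q _ => hconst q p
        rw [Matrix.trace, Finset.sum_congr rfl hq, Finset.sum_const, Finset.card_univ, nsmul_eq_mul]
      rw [(mem_gA d).1 hX] at htr
      have : Nonempty (UIndex d) := ⟨p⟩
      exact (mul_eq_zero.1 htr.symm).resolve_left (Nat.cast_ne_zero.2 Fintype.card_ne_zero)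
    · exact hdiag p q hpq
  irreducible := fun ω hω W hWg hinv hW X hX hXω => by
    refine mem_of_rootVectors (fun p q => Matrix.single p q 1) (regularA d)
      (gradingElement_centered_mem d _) ?_ hω hWg hinv hW ?_ hX hXω
    · intro p q hpq X _ h
      refine ⟨X p q, ?_⟩
      ext i j
      rw [Matrix.smul_apply, smul_eq_mul]
      by_cases hij : p = i ∧ q = j
      · rw [hij.1, hij.2, Matrix.single_apply_same, mul_one]
      · rw [Matrix.single_apply_of_ne _ _ _ _ _ hij, mul_zero]
        by_contra h0
        exact hij (eq_of_regularA_sub_eq d (h i j h0).symm hpq)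
    -- Equal differences mean equal blocks. Bracketing with the unit at (p', p) changes the row,
    -- then with the unit at (q, q') the column, up to sign; both units lie in 𝔨^ℂ.
    · intro p q p' q' hpq hpq' _ _ hE
      have hne : weightA d p ≠ weightA d q := fun h => by
        rw [h, sub_self] at hpq
        exact hω.ne hpq
      have hne1 : p.1 ≠ q.1 := by
        intro h
        rw [weightA_sub, h, sub_self] at hpq
        exact hω.ne hpq
      obtain ⟨h1, h2⟩ := eq_of_weightA_sub_eq d (hpq.trans hpq'.symm) hne
      have hE' : Matrix.single p' q (1 : ℂ) ∈ W := by
        by_cases hp : p' = p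
        · rwa [hp]
        · have := hinv _ (single_mem_isotropyComplex_gA d hp h1.symm) _ hE
          rw [Ring.lie_def, Matrix.single_mul_single_same, Matrix.single_mul_single_of_ne,
            sub_zero, mul_one] at this
          · exact this
          · rintro rfl
            exact hne1 h1
      by_cases hq : q = q'
      · rwa [← hq]
      · have := hinv _ (single_mem_isotropyComplex_gA d hq h2) _ hE'
        rw [Ring.lie_def, Matrix.single_mul_single_same, Matrix.single_mul_single_of_ne,
          zero_sub, mul_one, neg_mem_iff] at this
        · exact this
        · rintro rfl
          exact hne1 (h1.trans h2.symm)

theorem encard_positiveWeightsA (hd : ∀ i, 1 ≤ d i) :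
    (positiveWeights (gA d) (weightA d)).encard = (r * (r - 1) / 2 : ℕ) := by
  have himage : positiveWeights (gA d) (weightA d) =
      (fun x : Fin r × Fin r => factorWeight x.1 - factorWeight x.2) ''
        (Finset.univ.filter fun x : Fin r × Fin r => x.1 < x.2) := by
    ext ω
    constructor
    · rintro ⟨hω, p, q, -, h⟩
      rw [weightA_sub] at h
      refine ⟨(p.1, q.1), ?_, h⟩
      rw [← h, sub_pos, factorWeight_lt_iff] at hω
      simpa using hω
    · rintro ⟨⟨i, j⟩, hij, rfl⟩
      have hij : i < j := by simpa using hij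
      refine ⟨sub_pos.2 (factorWeight_lt_iff.2 hij), ⟨i, ⟨0, hd i⟩⟩, ⟨j, ⟨0, hd j⟩⟩,
        ⟨Matrix.single ⟨i, ⟨0, hd i⟩⟩ ⟨j, ⟨0, hd j⟩⟩ 1,
          single_mem_gA d ?_, ?_⟩, weightA_sub d _ _⟩
      · intro h
        exact hij.ne (congrArg Sigma.fst h)
      · rw [Matrix.single_apply_same]
        exact one_ne_zero
  rw [himage, Set.InjOn.encard_image, Set.encard_coe_eq_coe_finsetCard]
  · congr 1
    rw [← Finset.sum_range_id, Finset.sum_range, Finset.card_filter, Fintype.sum_prod_type_right]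
    refine Finset.sum_congr rfl fun j _ => ?_
    rw [← Finset.card_filter, ← Fin.card_Iio]
    congr 1
    ext i
    simp
  · rintro ⟨i, j⟩ hij ⟨i', j'⟩ _ h
    have hij : i < j := by simpa using hij
    have := eq_of_pow_sub_pow_eq (isSignedPower_factorWeight _) (isSignedPower_factorWeight _)
      (isSignedPower_factorWeight _) (isSignedPower_factorWeight _) (factorWeight_pos _)
      (factorWeight_pos _) h (factorWeight_injective.ne hij.ne)
    exact Prod.ext (factorWeight_injective this.1) (factorWeight_injective this.2)

theorem summandCountA (hd : ∀ i, 1 ≤ d i) :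
    SummandCount (gA d) (blockA d) (posA d) (r * (r - 1) / 2) := by
  have hg := isIrreducibleGradingA d
  have hcard := encard_positiveWeightsA d hd
  refine ⟨hg.hasIsotropySummands hcard, ?_⟩
  rw [← hcard]
  refine hg.encard_positiveTRoots ?_ ?_ ?_ ?_
  · intro p q hpq _
    refine ⟨Matrix.single p q 1, single_mem_gA d hpq, ?_, fun H hH => ?_⟩
    · rw [Matrix.single_apply_same]
      exact one_ne_zero
    · ext i j
      rw [lie_isDiag_apply hH.2, Matrix.smul_apply, smul_eq_mul]
      by_cases hij : p = i ∧ q = j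
      · rw [hij.1, hij.2]
      · rw [Matrix.single_apply_of_ne _ _ _ _ _ hij, mul_zero, mul_zero]
  · intro p q _ h
    rw [← sub_pos, weightA_sub, sub_pos, factorWeight_lt_iff] at h
    exact ⟨p, q, Sigma.lex_iff.2 (Or.inl h), rfl⟩
  · rintro _ ⟨p, q, hpq, rfl⟩
    rw [coord_sub_coord_gradingElement hg.gradingElement_mem, Complex.im_mul_ofReal, Complex.I_im,
      one_mul, weightA_sub, sub_nonneg]
    rcases Sigma.lex_iff.1 hpq with h | ⟨h, -⟩
    · exact (factorWeight_lt_iff.2 h).le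
    · rw [h]
  · intro p q p' q' hlt h H hH
    -- An element of 𝔱 commutes with the matrix units inside each block, so its diagonal is constant
    -- on blocks.
    have hconst : ∀ p p' : UIndex d, p.1 = p'.1 → H p p = H p' p' := by
      intro p p' hpp
      by_cases hne : p = p'
      · rw [hne]
      · have h := congr_fun (congr_fun (hH.2.2 _ (single_mem_isotropyComplex_gA d hne hpp)) p) p'
        rw [lie_isDiag_apply hH.1.2, Matrix.single_apply_same, mul_one, Matrix.zero_apply] at h
        exact sub_eq_zero.1 h
    obtain ⟨h1, h2⟩ := eq_of_weightA_sub_eq d h hlt.ne'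
    rw [hconst _ _ h1, hconst _ _ h2]

end TypeA

/-! ### Lie algebras of skew-adjoint matrices -/

section Paired

variable {N B : Type} [Fintype N] [DecidableEq N]

/-- `g` consists of the matrices that are skew-adjoint for the form pairing `p` with `σ p`, of
symmetry `ε`; the weights `wt` define the blocks, and the weights `μ` are regular. -/
structure IsPairedFrame (g : LieSubalgebra ℂ (Matrix N N ℂ)) (β : N → B) (σ : N → N) (s : N → ℂ)
    (ε : ℂ) (wt μ : N → ℝ) : Prop where
  pair_pair : ∀ p, σ (σ p) = p
  symm_eq : ε = 1 ∨ ε = -1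
  sign_eq : ∀ p, s p = 1 ∨ s p = -1
  sign_pair : ∀ p, s (σ p) = ε * s p
  mem_iff : ∀ X, X ∈ g ↔ ∀ p q, X (σ q) (σ p) = -(s p * s q) * X p q
  wt_eq_iff : ∀ p q, wt p = wt q ↔ β p = β q
  wt_pair : ∀ p, wt (σ p) = -wt p
  wt_isSignedPower : ∀ p, IsSignedPower (wt p)
  reg_pair : ∀ p, μ (σ p) = -μ p
  reg_isSignedPower : ∀ p, IsSignedPower (μ p)
  reg_injective : Function.Injective μ
  -- For ε = 1 there is no root vector joining p to σ p, so arguments linking these two rows must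
  -- pass through a third row z.
  exists_third : ∀ p, ε = 1 → σ p ≠ p → ∃ z, z ≠ p ∧ z ≠ σ p
  exists_third_of_wt_eq_zero : ∀ p, ε = 1 → σ p ≠ p → wt p = 0 → ∃ z, wt z = 0 ∧ z ≠ p ∧ z ≠ σ p

/-- The root vector for the root `ε_p - ε_q`. -/
def rootVector (σ : N → N) (s : N → ℂ) (p q : N) : Matrix N N ℂ :=
  Matrix.of fun i j =>
    (if i = p ∧ j = q then 1 else 0) - s p * s q * (if i = σ q ∧ j = σ p then 1 else 0)

omit [Fintype N] in
theorem rootVector_apply (σ : N → N) (s : N → ℂ) (p q i j : N) : rootVector σ s p q i j =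
    (if i = p ∧ j = q then 1 else 0) - s p * s q * (if i = σ q ∧ j = σ p then 1 else 0) := rfl

omit [Fintype N] in
theorem of_rootVector_apply_ne_zero {σ : N → N} {s : N → ℂ} {p q i j : N}
    (h : rootVector σ s p q i j ≠ 0) : (i = p ∧ j = q) ∨ (i = σ q ∧ j = σ p) := by
  by_contra hne
  push Not at hne
  refine h ?_
  rw [rootVector_apply, if_neg fun h' => hne.1 h'.1 h'.2, if_neg fun h' => hne.2 h'.1 h'.2,
    mul_zero, sub_zero]

namespace IsPairedFrame

variable {g : LieSubalgebra ℂ (Matrix N N ℂ)} {β : N → B} {σ : N → N} {s : N → ℂ} {ε : ℂ}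
  {wt μ : N → ℝ}

theorem sign_mul_self (hg : IsPairedFrame g β σ s ε wt μ) (p : N) : s p * s p = 1 := by
  rcases hg.sign_eq p with h | h <;> rw [h] <;> norm_num

theorem symm_mul_self (hg : IsPairedFrame g β σ s ε wt μ) : ε * ε = 1 := by
  rcases hg.symm_eq with h | h <;> rw [h] <;> norm_num

theorem pair_injective (hg : IsPairedFrame g β σ s ε wt μ) : Function.Injective σ :=
  Function.LeftInverse.injective hg.pair_pair

theorem sign_mul_sign_pair (hg : IsPairedFrame g β σ s ε wt μ) (p : N) : s p * s (σ p) = ε := by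
  rw [hg.sign_pair, mul_left_comm, hg.sign_mul_self, mul_one]

theorem rootVector_mem (hg : IsPairedFrame g β σ s ε wt μ) (p q : N) : rootVector σ s p q ∈ g := by
  rw [hg.mem_iff]
  intro i j
  have e1 : (σ j = p ∧ σ i = q) ↔ (i = σ q ∧ j = σ p) := by
    constructor
    · rintro ⟨rfl, rfl⟩; simp [hg.pair_pair]
    · rintro ⟨rfl, rfl⟩; simp [hg.pair_pair]
  have e2 : (σ j = σ q ∧ σ i = σ p) ↔ (i = p ∧ j = q) := by
    rw [hg.pair_injective.eq_iff, hg.pair_injective.eq_iff, and_comm]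
  rw [rootVector_apply, rootVector_apply]
  simp only [e1, e2]
  by_cases h1 : i = p ∧ j = q <;> by_cases h2 : i = σ q ∧ j = σ p
  · have hq : q = σ p := h1.2.symm.trans h2.2
    have hb := hg.sign_mul_sign_pair p
    rw [if_pos h1, if_pos h2, h1.1, h1.2, hq, hb]
    linear_combination -hg.symm_mul_self
  · rw [if_pos h1, if_neg h2, h1.1, h1.2]
    ring
  · rw [if_neg h1, if_pos h2, h2.1, h2.2, hg.sign_pair, hg.sign_pair]
    have h3 := hg.sign_mul_self p
    have h4 := hg.sign_mul_self q
    have h5 := hg.symm_mul_self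
    linear_combination (-(s p * s p) * (s q * s q)) * h5 - (s q * s q) * h3 - h4
  · rw [if_neg h1, if_neg h2]
    ring

/-- For q = σ p the two matrix units in the root vector coincide: they add up to 2 if ε = -1 and
would cancel if ε = 1. -/
theorem rootVector_apply_self (hg : IsPairedFrame g β σ s ε wt μ) {p q : N}
    (h : ε = -1 ∨ q ≠ σ p) : rootVector σ s p q p q = 1 ∨ rootVector σ s p q p q = 2 := by
  rw [rootVector_apply, if_pos ⟨rfl, rfl⟩]
  by_cases hq : q = σ p
  · have hε : ε = -1 := h.resolve_right fun h => h hq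
    right
    rw [if_pos ⟨by rw [hq, hg.pair_pair], hq⟩, hq, hg.sign_mul_sign_pair, hε]
    norm_num
  · left
    rw [if_neg fun h' => hq h'.2, mul_zero, sub_zero]

theorem rootVector_apply_self_ne_zero (hg : IsPairedFrame g β σ s ε wt μ) {p q : N}
    (h : ε = -1 ∨ q ≠ σ p) : rootVector σ s p q p q ≠ 0 := by
  rcases hg.rootVector_apply_self h with h | h <;> rw [h] <;> norm_num

/-- For ε = 1 the skewness relation at (p, σ p) reads X = -X. This is why ±2ε_p are roots only in
type C. -/
theorem of_apply_ne_zero (hg : IsPairedFrame g β σ s ε wt μ) {p q : N} {X : Matrix N N ℂ}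
    (hX : X ∈ g) (hpq : X p q ≠ 0) : ε = -1 ∨ q ≠ σ p := by
  by_contra hne
  push Not at hne
  have hε : ε = 1 := hg.symm_eq.resolve_right hne.1
  obtain rfl := hne.2
  have := (hg.mem_iff X).1 hX p (σ p)
  rw [hg.pair_pair, hg.sign_mul_sign_pair, hε] at this
  exact hpq (by linear_combination this / 2)

theorem exists_apply_ne_zero_iff (hg : IsPairedFrame g β σ s ε wt μ) {p q : N} :
    (∃ X ∈ g, X p q ≠ 0) ↔ (ε = -1 ∨ q ≠ σ p) :=
  ⟨fun ⟨_, hX, h⟩ => hg.of_apply_ne_zero hX h,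
    fun h => ⟨_, hg.rootVector_mem p q, hg.rootVector_apply_self_ne_zero h⟩⟩

/-- The positions (p, q) and (σ q, σ p) belong to one root. Passing between them turns moves of the
second index into moves of the first. -/
theorem rootVector_pair (hg : IsPairedFrame g β σ s ε wt μ) (p q : N) :
    rootVector σ s (σ q) (σ p) = (-(s p * s q)) • rootVector σ s p q := by
  ext i j
  have h3 := hg.sign_mul_self p
  have h4 := hg.sign_mul_self q
  have h5 := hg.symm_mul_self
  rw [Matrix.smul_apply, smul_eq_mul, rootVector_apply, rootVector_apply, hg.pair_pair,
    hg.pair_pair, hg.sign_pair, hg.sign_pair]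
  linear_combination (-(if i = p ∧ j = q then (1 : ℂ) else 0) * s p * s q) * h5 -
    (if i = σ q ∧ j = σ p then (1 : ℂ) else 0) * (s q * s q * h3 + h4)

theorem rootVector_pair_mem_iff (hg : IsPairedFrame g β σ s ε wt μ) (p q : N)
    (W : Submodule ℂ (Matrix N N ℂ)) :
    rootVector σ s (σ q) (σ p) ∈ W ↔ rootVector σ s p q ∈ W := by
  rw [hg.rootVector_pair, W.smul_mem_iff]
  have h3 := hg.sign_mul_self p
  have h4 := hg.sign_mul_self q
  rw [neg_ne_zero, mul_ne_zero_iff]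
  constructor
  · intro h; rw [h, zero_mul] at h3; exact zero_ne_one h3
  · intro h; rw [h, zero_mul] at h4; exact zero_ne_one h4

theorem apply_pair_pair (hg : IsPairedFrame g β σ s ε wt μ) {X : Matrix N N ℂ} (hX : X ∈ g)
    (p : N) : X (σ p) (σ p) = -X p p := by
  rw [(hg.mem_iff X).1 hX p p, hg.sign_mul_self]
  ring

theorem lie_rootVector (hg : IsPairedFrame g β σ s ε wt μ) {H : Matrix N N ℂ} (hH : H ∈ g)
    (hHd : H.IsDiag) (p q : N) :
    ⁅H, rootVector σ s p q⁆ = (H p p - H q q) • rootVector σ s p q := by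
  ext i j
  rw [lie_isDiag_apply hHd, Matrix.smul_apply, smul_eq_mul]
  by_cases h : rootVector σ s p q i j = 0
  · rw [h, mul_zero, mul_zero]
  · rcases of_rootVector_apply_ne_zero h with ⟨rfl, rfl⟩ | ⟨rfl, rfl⟩
    · rfl
    · rw [hg.apply_pair_pair hH, hg.apply_pair_pair hH]
      ring

theorem gradingElement_mem (hg : IsPairedFrame g β σ s ε wt μ) {ν : N → ℝ}
    (hν : ∀ p, ν (σ p) = -ν p) : gradingElement ν ∈ g := by
  rw [hg.mem_iff]
  intro p q
  by_cases h : p = q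
  · subst h
    rw [gradingElement, Matrix.diagonal_apply_eq, Matrix.diagonal_apply_eq, hν, hg.sign_mul_self]
    push_cast
    ring
  · rw [gradingElement, Matrix.diagonal_apply_ne _ h,
      Matrix.diagonal_apply_ne _ fun h' => h (hg.pair_injective h').symm, mul_zero]

theorem eq_or_eq_of_reg_sub_eq (hg : IsPairedFrame g β σ s ε wt μ) {p q i j : N} (hpq : p ≠ q)
    (h : μ i - μ j = μ p - μ q) : (i = p ∧ j = q) ∨ (i = σ q ∧ j = σ p) := by
  rcases (hg.reg_isSignedPower p).eq_of_add_eq_add (hg.reg_isSignedPower q).neg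
    (hg.reg_isSignedPower i) (hg.reg_isSignedPower j).neg (by linarith)
    (by rw [← sub_eq_add_neg]; exact sub_ne_zero.2 (hg.reg_injective.ne hpq)) with ⟨h1, h2⟩ | ⟨h1, h2⟩
  · exact Or.inl ⟨(hg.reg_injective h1).symm, (hg.reg_injective (neg_inj.1 h2)).symm⟩
  · rw [← hg.reg_pair] at h1 h2
    right
    rw [hg.reg_injective h1, ← hg.reg_injective h2, hg.pair_pair]
    exact ⟨rfl, rfl⟩

theorem eq_or_eq_of_wt_sub_eq (hg : IsPairedFrame g β σ s ε wt μ) {p q i j : N}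
    (hpq : wt p ≠ wt q) (h : wt p - wt q = wt i - wt j) :
    (wt p = wt i ∧ wt q = wt j) ∨ (wt p = wt (σ j) ∧ wt q = wt (σ i)) := by
  rcases (hg.wt_isSignedPower p).eq_of_add_eq_add (hg.wt_isSignedPower q).neg
    (hg.wt_isSignedPower i) (hg.wt_isSignedPower j).neg (by linarith)
    (by rw [← sub_eq_add_neg]; exact sub_ne_zero.2 hpq) with ⟨h1, h2⟩ | ⟨h1, h2⟩
  · exact Or.inl ⟨h1, neg_inj.1 h2⟩
  · right
    rw [hg.wt_pair, hg.wt_pair]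
    exact ⟨h1, by linarith⟩

theorem exists_eq_smul_rootVector (hg : IsPairedFrame g β σ s ε wt μ) {p q : N} (hpq : p ≠ q)
    {X : Matrix N N ℂ} (hX : X ∈ g) (h : ∀ i j, X i j ≠ 0 → μ i - μ j = μ p - μ q) :
    ∃ c : ℂ, X = c • rootVector σ s p q := by
  -- The root vector may have zero entry here, but only when X p q = 0 as well; the quotient is then
  -- 0.
  have hc : X p q = X p q / rootVector σ s p q p q * rootVector σ s p q p q := by
    by_cases h0 : X p q = 0
    · rw [h0, zero_div, zero_mul]
    · rw [div_mul_cancel₀]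
      exact hg.rootVector_apply_self_ne_zero (hg.of_apply_ne_zero hX h0)
  refine ⟨X p q / rootVector σ s p q p q, ?_⟩
  ext i j
  rw [Matrix.smul_apply, smul_eq_mul]
  by_cases hij : (i = p ∧ j = q) ∨ (i = σ q ∧ j = σ p)
  · rcases hij with ⟨rfl, rfl⟩ | ⟨rfl, rfl⟩
    · exact hc
    · rw [(hg.mem_iff X).1 hX, (hg.mem_iff _).1 (hg.rootVector_mem p q)]
      linear_combination (-(s p * s q)) * hc
  · have h1 : X i j = 0 := by
      by_contra h0
      exact hij (hg.eq_or_eq_of_reg_sub_eq hpq (h i j h0))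
    have h2 : rootVector σ s p q i j = 0 := by
      by_contra h0
      exact hij (of_rootVector_apply_ne_zero h0)
    rw [h1, h2, mul_zero]

theorem rootVector_mem_isotropyComplex (hg : IsPairedFrame g β σ s ε wt μ) {p q : N}
    (h : wt p = wt q) : rootVector σ s p q ∈ isotropyComplex g β := by
  refine ⟨hg.rootVector_mem p q, fun i j hij => ?_⟩
  by_contra h0
  refine hij ((hg.wt_eq_iff i j).1 ?_)
  rcases of_rootVector_apply_ne_zero h0 with ⟨rfl, rfl⟩ | ⟨rfl, rfl⟩
  · exact h
  · rw [hg.wt_pair, hg.wt_pair, h]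

/-- At (p', q) the first product has entry 1, 2 or 4. The reversed product contributes only if q = σ
p', and then its entry is ε = -1, which is subtracted. So nothing cancels. -/
theorem lie_rootVector_apply_ne_zero (hg : IsPairedFrame g β σ s ε wt μ) {p p' q : N}
    (hp : p' ≠ p) (hpq : p ≠ q) (h1 : ε = -1 ∨ p' ≠ σ p) (h2 : ε = -1 ∨ q ≠ σ p)
    (h3 : ε = -1 ∨ q ≠ σ p') : ⁅rootVector σ s p' p, rootVector σ s p q⁆ p' q ≠ 0 := by
  have hA : (rootVector σ s p' p * rootVector σ s p q) p' q =
      rootVector σ s p' p p' p * rootVector σ s p q p q := by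
    rw [Matrix.mul_apply, Finset.sum_eq_single p]
    · intro l _ hl
      rw [show rootVector σ s p' p p' l = 0 from ?_, zero_mul]
      by_contra h0
      rcases of_rootVector_apply_ne_zero h0 with ⟨-, h⟩ | ⟨h, h'⟩
      · exact hl h
      · exact hl (by rw [h', h, hg.pair_pair])
    · simp
  have hB : (rootVector σ s p q * rootVector σ s p' p) p' q = if q = σ p' then ε else 0 := by
    rw [Matrix.mul_apply, Finset.sum_eq_single (σ p)]
    · have e1 : ¬(p' = p ∧ σ p = q) := fun h => hp h.1
      have e2 : ¬(σ p = p' ∧ q = p) := fun h => hpq h.2.symm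
      have e3 : p' = σ q ↔ q = σ p' :=
        ⟨fun h => by rw [h, hg.pair_pair], fun h => by rw [h, hg.pair_pair]⟩
      simp only [rootVector_apply, e3, and_true, true_and]
      rw [if_neg e1, if_neg e2]
      by_cases h : q = σ p'
      · rw [if_pos h, if_pos h, h]
        have := hg.sign_mul_self p
        linear_combination (s p' * s (σ p')) * this + hg.sign_mul_sign_pair p'
      · rw [if_neg h, if_neg h]
        ring
    · intro l _ hl
      rw [show rootVector σ s p q p' l = 0 from ?_, zero_mul]
      by_contra h0
      rcases of_rootVector_apply_ne_zero h0 with ⟨h, -⟩ | ⟨-, h⟩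
      · exact hp h
      · exact hl h
    · simp
  have h1' : ε = -1 ∨ p ≠ σ p' := h1.imp_right fun h h' => h (by rw [h', hg.pair_pair])
  rw [Ring.lie_def, Matrix.sub_apply, hA, hB]
  have hif : (if q = σ p' then ε else 0) = 0 ∨ (if q = σ p' then ε else 0) = -1 := by
    split_ifs with h
    · exact Or.inr (h3.resolve_right fun h' => h' h)
    · exact Or.inl rfl
  rcases hg.rootVector_apply_self h1' with h | h <;>
    rcases hg.rootVector_apply_self h2 with h' | h' <;>
    rcases hif with h'' | h'' <;> rw [h, h', h''] <;> norm_num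

/-! ### Moving root vectors within the blocks by brackets with 𝔨^ℂ. -/

section Connected

variable {W : Submodule ℂ (Matrix N N ℂ)}

theorem rootVector_mem_of_wt_eq (hg : IsPairedFrame g β σ s ε wt μ)
    (hinv : ∀ Z ∈ isotropyComplex g β, ∀ X ∈ W, ⁅Z, X⁆ ∈ W) {p p' q : N} (hp : wt p' = wt p)
    (hpq : wt p ≠ wt q) (h1 : ε = -1 ∨ p' ≠ σ p) (h2 : ε = -1 ∨ q ≠ σ p) (h3 : ε = -1 ∨ q ≠ σ p')
    (hE : rootVector σ s p q ∈ W) : rootVector σ s p' q ∈ W := by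
  by_cases hpp : p' = p
  · rwa [hpp]
  have hpq' : p' ≠ q := fun h => hpq (by rw [← hp, h])
  have hpq0 : p ≠ q := fun h => hpq (by rw [h])
  set Y := ⁅rootVector σ s p' p, rootVector σ s p q⁆ with hY
  have hYW : Y ∈ W := hinv _ (hg.rootVector_mem_isotropyComplex hp) _ hE
  have hY0 : Y p' q ≠ 0 := hg.lie_rootVector_apply_ne_zero hpp hpq0 h1 h2 h3
  have hYg : Y ∈ g := g.lie_mem (hg.rootVector_mem _ _) (hg.rootVector_mem _ _)
  have hμ : gradingElement μ ∈ g := hg.gradingElement_mem hg.reg_pair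
  -- By the Jacobi identity the regular eigenvalues add up to that of (p', q), so Y is a multiple of
  -- that root vector.
  have hbr : ⁅gradingElement μ, Y⁆ = (Complex.I * ((μ p' - μ q : ℝ) : ℂ)) • Y := by
    rw [hY, leibniz_lie, hg.lie_rootVector hμ (Matrix.isDiag_diagonal _),
      hg.lie_rootVector hμ (Matrix.isDiag_diagonal _), smul_lie, lie_smul, ← add_smul]
    congr 1
    simp only [gradingElement, Matrix.diagonal_apply_eq]
    push_cast
    ring
  obtain ⟨c, hc⟩ := hg.exists_eq_smul_rootVector hpq' hYg fun i j hij => by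
    have := congr_fun (congr_fun hbr i) j
    rw [lie_gradingElement_apply, Matrix.smul_apply, smul_eq_mul] at this
    exact Complex.ofReal_injective (mul_left_cancel₀ Complex.I_ne_zero (mul_right_cancel₀ hij this))
  have hc0 : c ≠ 0 := by
    rintro rfl
    rw [hc, zero_smul] at hY0
    exact hY0 rfl
  rwa [hc, W.smul_mem_iff hc0] at hYW

/-- The only forbidden direct move is p to σ p with ε = 1. Both rows then have weight 0, and a third
row of weight 0 gives a detour. -/
theorem rootVector_mem_of_wt_eq_of_wt_ne_neg (hg : IsPairedFrame g β σ s ε wt μ)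
    (hinv : ∀ Z ∈ isotropyComplex g β, ∀ X ∈ W, ⁅Z, X⁆ ∈ W) {p p' q : N} (hp : wt p' = wt p)
    (hpq : wt p ≠ wt q) (hpq' : wt q ≠ -wt p) (hE : rootVector σ s p q ∈ W) :
    rootVector σ s p' q ∈ W := by
  have hq : ∀ z, wt z = wt p → q ≠ σ z := by
    rintro z hz rfl
    exact hpq' (by rw [hg.wt_pair, hz])
  by_cases h1 : ε = -1 ∨ p' ≠ σ p
  · exact hg.rootVector_mem_of_wt_eq hinv hp hpq h1 (Or.inr (hq p rfl)) (Or.inr (hq p' hp)) hE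
  · push Not at h1
    obtain ⟨hε, rfl⟩ := h1
    by_cases hpp : σ p = p
    · rwa [hpp]
    have hp0 : wt p = 0 := by
      have := hg.wt_pair p
      linarith
    obtain ⟨z, hz, hzp, hzp'⟩ := hg.exists_third_of_wt_eq_zero p (hg.symm_eq.resolve_right hε) hpp hp0
    have hzwt : wt z = wt p := hz.trans hp0.symm
    have hEz := hg.rootVector_mem_of_wt_eq hinv hzwt hpq (Or.inr hzp') (Or.inr (hq p rfl))
      (Or.inr (hq z hzwt)) hE
    exact hg.rootVector_mem_of_wt_eq hinv (hp.trans hzwt.symm) (hzwt ▸ hpq)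
      (Or.inr fun h => hzp (hg.pair_injective h).symm) (Or.inr (hq z hzwt)) (Or.inr (hq _ hp)) hEz

/-- Move the first index, then the second after exchanging roles by the pairing. If wt q = -wt p,
the intermediate root vector may be absent and the order of moves matters. -/
theorem rootVector_mem_of_wt_eq_of_wt_eq (hg : IsPairedFrame g β σ s ε wt μ)
    (hinv : ∀ Z ∈ isotropyComplex g β, ∀ X ∈ W, ⁅Z, X⁆ ∈ W) {p p' q q' : N} (hp : wt p' = wt p)
    (hq : wt q' = wt q) (hpq : wt p ≠ wt q) (h1 : ε = -1 ∨ q ≠ σ p) (h2 : ε = -1 ∨ q' ≠ σ p')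
    (hE : rootVector σ s p q ∈ W) : rootVector σ s p' q' ∈ W := by
  have hσ : ∀ {x y}, wt x = wt y → wt (σ x) = wt (σ y) := fun h => by
    rw [hg.wt_pair, hg.wt_pair, h]
  have hpq' : wt (σ q) ≠ wt (σ p') := by
    rw [hg.wt_pair, hg.wt_pair, hp]
    exact fun h => hpq (neg_inj.1 h).symm
  by_cases hneg : wt q = -wt p
  · have hne : ∀ {x y}, wt x = wt y → wt x ≠ 0 → x ≠ σ y := by
      rintro x y h h0 rfl
      rw [hg.wt_pair] at h h0
      exact h0 (by linarith)
    have hp0 : wt p ≠ 0 := fun h => hpq (by rw [hneg, h, neg_zero])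
    by_cases h3 : ε = -1 ∨ q ≠ σ p'
    · have hE1 := hg.rootVector_mem_of_wt_eq hinv hp hpq (Or.inr (hne hp (hp ▸ hp0))) h1 h3 hE
      rw [← hg.rootVector_pair_mem_iff] at hE1 ⊢
      refine hg.rootVector_mem_of_wt_eq hinv (hσ hq) hpq' (Or.inr (hne (hσ hq) ?_)) ?_ ?_ hE1
      · rw [hg.wt_pair, hq, hneg, neg_neg]
        exact hp0
      · exact h3.imp_right fun h h' => h (by rw [h', hg.pair_pair])
      · exact h2.imp_right fun h h' => h (by rw [h', hg.pair_pair])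
    · push Not at h3
      obtain ⟨hε, rfl⟩ := h3
      -- Here q = σ p' and ε = 1. The target is proportional to the root vector of (σ q', q), so
      -- moving p to σ q' suffices.
      have hq' : wt (σ q') = wt p := by rw [hg.wt_pair, hq, hneg, neg_neg]
      rw [← hg.rootVector_pair_mem_iff]
      refine hg.rootVector_mem_of_wt_eq hinv hq' hpq (Or.inr (hne hq' (hq' ▸ hp0))) h1 (Or.inr ?_) hE
      rw [hg.pair_pair]
      exact fun h => h2.resolve_left hε h.symm
  · have hE1 := hg.rootVector_mem_of_wt_eq_of_wt_ne_neg hinv hp hpq hneg hE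
    rw [← hg.rootVector_pair_mem_iff] at hE1 ⊢
    refine hg.rootVector_mem_of_wt_eq_of_wt_ne_neg hinv (hσ hq) hpq' ?_ hE1
    rw [hg.wt_pair, hg.wt_pair, hp]
    exact fun h => hneg (by linarith)

end Connected

theorem apply_eq_apply_of_lie_eq_zero (hg : IsPairedFrame g β σ s ε wt μ) {H : Matrix N N ℂ}
    (hH : H ∈ g) (hHd : H.IsDiag) {p q : N} (hpq : ε = -1 ∨ q ≠ σ p)
    (h : ⁅H, rootVector σ s p q⁆ = 0) : H p p = H q q := by
  rw [hg.lie_rootVector hH hHd] at h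
  have := congr_fun (congr_fun h p) q
  exact sub_eq_zero.1 ((mul_eq_zero.1 this).resolve_right (hg.rootVector_apply_self_ne_zero hpq))

theorem eq_zero_of_lie_eq_zero (hg : IsPairedFrame g β σ s ε wt μ) {X : Matrix N N ℂ} (hX : X ∈ g)
    (hcomm : ∀ Y ∈ g, ⁅X, Y⁆ = 0) : X = 0 := by
  have hXd : X.IsDiag := by
    intro p q hpq
    have h := hcomm _ (hg.gradingElement_mem hg.reg_pair)
    rw [← lie_skew, neg_eq_zero] at h
    have h := congr_fun (congr_fun h p) q
    rw [lie_gradingElement_apply, Matrix.zero_apply] at h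
    refine (mul_eq_zero.1 h).resolve_left (mul_ne_zero Complex.I_ne_zero ?_)
    exact Complex.ofReal_ne_zero.2 (sub_ne_zero.2 (hg.reg_injective.ne hpq))
  have hconst : ∀ {p q}, (ε = -1 ∨ q ≠ σ p) → X p p = X q q := fun h =>
    hg.apply_eq_apply_of_lie_eq_zero hX hXd h (hcomm _ (hg.rootVector_mem _ _))
  ext p q
  by_cases hpq : p = q
  · subst hpq
    -- Commuting with root vectors equates these entries, through a third row if ε = 1, while
    -- skewness makes them opposite.
    have h1 : X p p = X (σ p) (σ p) := by
      by_cases hp : σ p = p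
      · rw [hp]
      · rcases hg.symm_eq with hε | hε
        · obtain ⟨z, hz, hz'⟩ := hg.exists_third p hε hp
          rw [hconst (Or.inr hz'), hconst (p := z) (q := σ p)
            (Or.inr fun h => hz (hg.pair_injective h).symm)]
        · exact hconst (Or.inl hε)
    rw [hg.apply_pair_pair hX] at h1
    rw [Matrix.zero_apply]
    linear_combination h1 / 2
  · exact hXd hpq

/-- Root vectors inside a block lie in 𝔨^ℂ and commute with 𝔱. The pair p, σ p in the block of
weight 0 is linked through a third row when ε = 1. -/
theorem apply_eq_apply_of_mem_tSpace (hg : IsPairedFrame g β σ s ε wt μ) {H : Matrix N N ℂ}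
    (hH : H ∈ tSpace g β) {p q : N} (hpq : wt p = wt q) : H p p = H q q := by
  have hconst : ∀ {p q}, wt p = wt q → (ε = -1 ∨ q ≠ σ p) → H p p = H q q := fun hwt h =>
    hg.apply_eq_apply_of_lie_eq_zero hH.1.1 hH.1.2 h
      (hH.2.2 _ (hg.rootVector_mem_isotropyComplex hwt))
  by_cases h : ε = -1 ∨ q ≠ σ p
  · exact hconst hpq h
  · push Not at h
    obtain ⟨hε, rfl⟩ := h
    by_cases hp : σ p = p
    · rw [hp]
    have hp0 : wt p = 0 := by
      have := hg.wt_pair p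
      linarith
    obtain ⟨z, hz0, hz, hz'⟩ :=
      hg.exists_third_of_wt_eq_zero p (hg.symm_eq.resolve_right hε) hp hp0
    rw [hconst (hp0.trans hz0.symm) (Or.inr hz'), hconst (p := z) (q := σ p)
      (by rw [hz0, ← hpq, hp0]) (Or.inr fun h => hz (hg.pair_injective h).symm)]

theorem isIrreducibleGrading (hg : IsPairedFrame g β σ s ε wt μ) :
    IsIrreducibleGrading g β wt where
  conjTranspose_mem := fun X hX => by
    have hs : ∀ p, star (s p) = s p := fun p => by
      rcases hg.sign_eq p with h | h <;> rw [h] <;> simp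
    rw [hg.mem_iff] at hX ⊢
    intro p q
    rw [Matrix.conjTranspose_apply, Matrix.conjTranspose_apply, hX q p, star_mul', star_neg,
      star_mul', hs, hs, mul_comm (s q)]
  gradingElement_mem := hg.gradingElement_mem hg.wt_pair
  wt_eq_iff := hg.wt_eq_iff
  eq_zero_of_lie_eq_zero := fun _ hX h => hg.eq_zero_of_lie_eq_zero hX h
  irreducible := fun ω hω W hWg hinv hW X hX hXω => by
    refine mem_of_rootVectors (rootVector σ s) μ (hg.gradingElement_mem hg.reg_pair)
      (fun p q hpq X hX h => hg.exists_eq_smul_rootVector hpq hX h) hω hWg hinv hW ?_ hX hXω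
    intro p q p' q' h h' hocc hocc' hE
    rw [hg.exists_apply_ne_zero_iff] at hocc hocc'
    have hne : wt p ≠ wt q := fun h0 => hω.ne (by rw [← h, h0, sub_self])
    rcases hg.eq_or_eq_of_wt_sub_eq hne (h.trans h'.symm) with ⟨h1, h2⟩ | ⟨h1, h2⟩
    · exact hg.rootVector_mem_of_wt_eq_of_wt_eq hinv h1.symm h2.symm hne hocc hocc' hE
    · rw [← hg.rootVector_pair_mem_iff]
      refine hg.rootVector_mem_of_wt_eq_of_wt_eq hinv h1.symm h2.symm hne hocc
        (hocc'.imp_right fun h h' => h ?_) hE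
      rw [hg.pair_injective h', hg.pair_pair]

theorem summandCount (hg : IsPairedFrame g β σ s ε wt μ) {pos : Set (Module.Dual ℂ (cartan g))}
    {k : ℕ}
    (hpos : ∀ p q, (ε = -1 ∨ q ≠ σ p) → wt q < wt p → coord g p - coord g q ∈ pos)
    (hpos' : ∀ α ∈ pos, ∃ p q, wt q ≤ wt p ∧ α = coord g p - coord g q)
    (hk : (positiveWeights g wt).encard = k) : SummandCount g β pos k := by
  have hg' := hg.isIrreducibleGrading
  refine ⟨hg'.hasIsotropySummands hk, ?_⟩
  rw [← hk]
  refine hg'.encard_positiveTRoots ?_ ?_ ?_ ?_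
  · intro p q _ hocc
    rw [hg.exists_apply_ne_zero_iff] at hocc
    exact ⟨_, hg.rootVector_mem p q, hg.rootVector_apply_self_ne_zero hocc,
      fun H hH => hg.lie_rootVector hH.1 hH.2 p q⟩
  · intro p q hocc h
    exact hpos p q (hg.exists_apply_ne_zero_iff.1 hocc) h
  · intro α hα
    obtain ⟨p, q, h, rfl⟩ := hpos' α hα
    rw [coord_sub_coord_gradingElement hg'.gradingElement_mem, Complex.im_mul_ofReal, Complex.I_im,
      one_mul, sub_nonneg]
    exact h
  · intro p q p' q' hlt h H hH
    rcases hg.eq_or_eq_of_wt_sub_eq hlt.ne' h with ⟨h1, h2⟩ | ⟨h1, h2⟩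
    · rw [hg.apply_eq_apply_of_mem_tSpace hH h1, hg.apply_eq_apply_of_mem_tSpace hH h2]
    · rw [hg.apply_eq_apply_of_mem_tSpace hH h1, hg.apply_eq_apply_of_mem_tSpace hH h2,
        hg.apply_pair_pair hH.1.1, hg.apply_pair_pair hH.1.1]
      ring

theorem coord_pair (hg : IsPairedFrame g β σ s ε wt μ) (p : N) :
    coord g (σ p) = -coord g p := by
  ext H
  exact hg.apply_pair_pair H.2.1 p

end IsPairedFrame

end Paired

/-! ### The number of positive weights in types B, C, D -/

section Counting

variable {r : ℕ}

/-- The positive weights, listed by pairs: `w i` for `none`, and `w i - w j` or `w i + w j` for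
`some j`, according to whether `i < j`. -/
def pairWeight (x : Fin r × Option (Fin r)) : ℝ :=
  factorWeight x.1 + x.2.elim 0 fun j => if x.1 < j then -factorWeight j else factorWeight j

theorem pairWeight_none (i : Fin r) : pairWeight (i, none) = factorWeight i := add_zero _

theorem pairWeight_of_lt {i j : Fin r} (h : i < j) :
    pairWeight (i, some j) = factorWeight i - factorWeight j := by
  simp [pairWeight, h, sub_eq_add_neg]

theorem pairWeight_of_le {i j : Fin r} (h : j ≤ i) :
    pairWeight (i, some j) = factorWeight i + factorWeight j := by
  simp [pairWeight, h.not_gt]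

theorem pairWeight_pos (x : Fin r × Option (Fin r)) : 0 < pairWeight x := by
  obtain ⟨i, _ | j⟩ := x
  · rw [pairWeight_none]
    exact factorWeight_pos i
  · rcases lt_or_ge i j with h | h
    · rw [pairWeight_of_lt h, sub_pos]
      exact factorWeight_lt_iff.2 h
    · rw [pairWeight_of_le h]
      exact add_pos (factorWeight_pos i) (factorWeight_pos j)

/-- A sum of two signed powers fixes its terms up to order. Only sums of two positive powers allow
an exchange, and there the convention j ≤ i leaves one listing. -/
theorem pairWeight_injective : Function.Injective (pairWeight (r := r)) := by
  have hsign : ∀ x : Fin r × Option (Fin r), IsSignedPower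
      (x.2.elim 0 fun j => if x.1 < j then -factorWeight j else factorWeight j) := by
    rintro ⟨i, _ | j⟩
    · exact isSignedPower_zero
    · simp only [Option.elim_some]
      split_ifs
      · exact (isSignedPower_factorWeight j).neg
      · exact isSignedPower_factorWeight j
  rintro ⟨i, o⟩ ⟨i', o'⟩ h
  rcases (isSignedPower_factorWeight i).eq_of_add_eq_add (hsign (i, o))
    (isSignedPower_factorWeight i') (hsign (i', o')) h (pairWeight_pos (i, o)).ne' with
    ⟨h1, h2⟩ | ⟨h1, h2⟩
  · obtain rfl := factorWeight_injective h1
    obtain _ | j := o <;> obtain _ | j' := o'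
    · rfl
    · have := factorWeight_pos j'
      simp only [Option.elim_none, Option.elim_some] at h2
      split_ifs at h2 <;> linarith
    · have := factorWeight_pos j
      simp only [Option.elim_none, Option.elim_some] at h2
      split_ifs at h2 <;> linarith
    · have := factorWeight_pos j
      have := factorWeight_pos j'
      simp only [Option.elim_some] at h2
      have hj : factorWeight j = factorWeight j' := by split_ifs at h2 <;> linarith
      rw [factorWeight_injective hj]
  · have key : ∀ (i i' : Fin r) (o : Option (Fin r)), (o.elim 0 fun j => if i < j then
        -factorWeight j else factorWeight j) = factorWeight i' → o = some i' ∧ i' ≤ i := by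
      rintro i i' (_ | j) h
      · exact absurd h (factorWeight_pos i').ne
      · simp only [Option.elim_some] at h
        split_ifs at h with hlt
        · have := factorWeight_pos j
          have := factorWeight_pos i'
          linarith
        · obtain rfl := factorWeight_injective h
          exact ⟨rfl, not_lt.1 hlt⟩
    obtain ⟨rfl, h3⟩ := key _ _ _ h2
    obtain ⟨rfl, h4⟩ := key _ _ _ h1.symm
    rw [le_antisymm h3 h4]

open Classical in
theorem card_filter_pair (P : Prop) (C : Fin r → Prop) :
    (Finset.univ.filter fun x : Fin r × Option (Fin r) =>
      x.2.elim P fun j => x.1 ≠ j ∨ C x.1).card =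
      r * (r - 1) + (Finset.univ.filter C).card + if P then r else 0 := by
  -- Row i has r - 1 off-diagonal pairs, plus the diagonal one under C i; the existence of i keeps
  -- the natural subtraction exact.
  have hrow : ∀ i : Fin r, ∑ j, (if i ≠ j ∨ C i then 1 else 0) = (r - 1) + if C i then 1 else 0 := by
    intro i
    by_cases hC : C i
    · simp only [hC, or_true, if_true, Finset.sum_const, Finset.card_univ, Fintype.card_fin,
        smul_eq_mul, mul_one]
      have := i.pos
      omega
    · simp only [hC, or_false, if_false, ← Finset.card_filter, add_zero]
      rw [Finset.filter_ne, Finset.card_erase_of_mem (Finset.mem_univ i), Finset.card_univ,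
        Fintype.card_fin]
  have hsum : ∀ i : Fin r, (∑ o : Option (Fin r),
      if o.elim P fun j => i ≠ j ∨ C i then 1 else 0) =
      (if P then 1 else 0) + ((r - 1) + if C i then 1 else 0) := fun i => by
    rw [Fintype.sum_option, ← hrow]
    exact congrArg₂ _ (if_congr Iff.rfl rfl rfl)
      (Finset.sum_congr rfl fun j _ => if_congr Iff.rfl rfl rfl)
  rw [Finset.card_filter, Fintype.sum_prod_type, Finset.sum_congr rfl fun i _ => hsum i,
    Finset.sum_add_distrib, Finset.sum_add_distrib, Finset.card_filter]
  simp only [Finset.sum_const, Finset.card_univ, Fintype.card_fin, smul_eq_mul]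
  split_ifs <;> ring

variable {N B : Type} [Fintype N] [DecidableEq N] {g : LieSubalgebra ℂ (Matrix N N ℂ)} {β : N → B}
  {σ : N → N} {s : N → ℂ} {ε : ℂ} {wt μ : N → ℝ}

open Classical in
theorem IsPairedFrame.encard_positiveWeights (hg : IsPairedFrame g β σ s ε wt μ) {d : Fin r → ℕ}
    (hd : ∀ i, 1 ≤ d i) (ι : UIndex d → N) (hι : Function.Injective ι)
    (hwt : ∀ x, wt (ι x) = factorWeight x.1)
    (hcases : ∀ p, (∃ x, p = ι x) ∨ (∃ x, p = σ (ι x)) ∨ wt p = 0) :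
    (positiveWeights g wt).encard = ((r * (r - 1) +
      (Finset.univ.filter fun i => ε = -1 ∨ 1 < d i).card +
      if ∃ p, wt p = 0 then r else 0 : ℕ) : ℕ∞) := by
  have himage : positiveWeights g wt = pairWeight '' ((Finset.univ.filter
      fun x : Fin r × Option (Fin r) => x.2.elim (∃ p, wt p = 0)
        fun j => x.1 ≠ j ∨ (ε = -1 ∨ 1 < d x.1) : Finset (Fin r × Option (Fin r))) :
      Set (Fin r × Option (Fin r))) := by
    have hwt' : ∀ x, wt (σ (ι x)) = -factorWeight x.1 := fun x => by rw [hg.wt_pair, hwt]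
    ext ω
    simp only [positiveWeights, hg.exists_apply_ne_zero_iff, Set.mem_ofPred_eq, Set.mem_image,
      Finset.coe_filter, Finset.mem_univ, true_and]
    constructor
    · rintro ⟨hω, p, q, hocc, rfl⟩
      rcases hcases p with ⟨⟨i, a⟩, rfl⟩ | ⟨⟨i, a⟩, rfl⟩ | hp <;>
        rcases hcases q with ⟨⟨j, b⟩, rfl⟩ | ⟨⟨j, b⟩, rfl⟩ | hq
      · rw [hwt, hwt] at hω ⊢
        have hij := factorWeight_lt_iff.1 (sub_pos.1 hω)
        exact ⟨(i, some j), Or.inl hij.ne, pairWeight_of_lt hij⟩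
      · rw [hwt, hwt', sub_neg_eq_add]
        rcases lt_trichotomy i j with hij | rfl | hij
        · exact ⟨(j, some i), Or.inl hij.ne', (pairWeight_of_le hij.le).trans (add_comm _ _)⟩
        -- The weight 2w_i sits at (p, σ q) with p, q in block i. For ε = 1 the case p = q is
        -- excluded, so the block has two coordinates.
        · refine ⟨(i, some i), Or.inr (hocc.imp_right fun h => ?_), pairWeight_of_le le_rfl⟩
          have hab : b ≠ a := fun hab => h (by rw [hab])
          have ha := a.2
          have hb := b.2
          have : (b : ℕ) ≠ a := fun h' => hab (Fin.ext h')
          simp only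
          omega
        · exact ⟨(i, some j), Or.inl hij.ne', pairWeight_of_le hij.le⟩
      · exact ⟨(i, none), ⟨q, hq⟩, by rw [pairWeight_none, hwt, hq, sub_zero]⟩
      · rw [hwt, hwt'] at hω
        have := factorWeight_pos i
        have := factorWeight_pos j
        simp only at hω
        linarith
      · rw [hwt', hwt'] at hω ⊢
        have hij : j < i := factorWeight_lt_iff.1 (by simp only at hω; linarith)
        refine ⟨(j, some i), Or.inl hij.ne, (pairWeight_of_lt hij).trans ?_⟩
        simp only
        ring
      · rw [hwt', hq] at hω
        have := factorWeight_pos i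
        simp only at hω
        linarith
      · rw [hwt, hp] at hω
        have := factorWeight_pos j
        simp only at hω
        linarith
      · exact ⟨(j, none), ⟨p, hp⟩, by rw [pairWeight_none, hwt', hp, sub_neg_eq_add, zero_add]⟩
      · rw [hp, hq, sub_zero] at hω
        exact absurd hω (lt_irrefl 0)
    · rintro ⟨⟨i, o⟩, h, rfl⟩
      refine ⟨pairWeight_pos _, ?_⟩
      have hi := factorWeight_pos i
      obtain _ | j := o
      · obtain ⟨q, hq⟩ := h
        refine ⟨ι ⟨i, ⟨0, hd i⟩⟩, q, Or.inr ?_, by rw [hwt, hq, pairWeight_none, sub_zero]⟩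
        rintro rfl
        rw [hwt'] at hq
        simp only at hq
        linarith
      · have hj := factorWeight_pos j
        rcases lt_trichotomy i j with hij | rfl | hij
        · refine ⟨ι ⟨i, ⟨0, hd i⟩⟩, ι ⟨j, ⟨0, hd j⟩⟩, Or.inr fun h => ?_,
            by rw [hwt, hwt, pairWeight_of_lt hij]⟩
          have := congrArg wt h
          rw [hwt, hwt'] at this
          simp only at this
          linarith
        · rcases h with h | h | h
          · exact absurd rfl h
          · exact ⟨ι ⟨i, ⟨0, hd i⟩⟩, σ (ι ⟨i, ⟨0, hd i⟩⟩), Or.inl h,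
              by rw [hwt', hwt, pairWeight_of_le le_rfl, sub_neg_eq_add]⟩
          -- A second coordinate of the block avoids the vanishing entry at (p, σ p).
          · refine ⟨ι ⟨i, ⟨0, hd i⟩⟩, σ (ι ⟨i, ⟨1, h⟩⟩), Or.inr fun h => ?_,
              by rw [hwt', hwt, pairWeight_of_le le_rfl, sub_neg_eq_add]⟩
            have := hι (hg.pair_injective h)
            simp at this
        · refine ⟨ι ⟨i, ⟨0, hd i⟩⟩, σ (ι ⟨j, ⟨0, hd j⟩⟩), Or.inr fun h => ?_,
            by rw [hwt', hwt, pairWeight_of_le hij.le, sub_neg_eq_add]⟩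
          exact hij.ne (congrArg Sigma.fst (hι (hg.pair_injective h)))
  rw [himage, pairWeight_injective.encard_image, Set.encard_coe_eq_coe_finsetCard]
  convert congrArg (Nat.cast : ℕ → ℕ∞)
    (card_filter_pair (∃ p, wt p = 0) fun i => ε = -1 ∨ 1 < d i)

end Counting

/-! ### Weights of the coordinates -/

section CoordinateWeights

variable {r : ℕ} (d : Fin r → ℕ) (t : ℕ)

/-- The weight of a coordinate; it vanishes on the coordinates of the remaining factor. -/
def indexWeight : Index d t → ℝ := Sum.elim (fun x => factorWeight x.1) fun _ => 0

theorem indexWeight_inl (x : UIndex d) : indexWeight d t (Sum.inl x) = factorWeight x.1 := rfl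

theorem indexWeight_inr (a : Fin t) : indexWeight d t (Sum.inr a) = 0 := rfl

theorem indexWeight_nonneg (x : Index d t) : 0 ≤ indexWeight d t x := by
  obtain x | a := x
  · exact (factorWeight_pos x.1).le
  · exact le_rfl

theorem indexWeight_eq_iff (x y : Index d t) :
    indexWeight d t x = indexWeight d t y ↔ Index.block d t x = Index.block d t y := by
  obtain x | a := x <;> obtain y | b := y
  · rw [indexWeight_inl, indexWeight_inl, factorWeight_injective.eq_iff]
    exact (Option.some_inj).symm
  · rw [indexWeight_inl, indexWeight_inr]
    exact iff_of_false (factorWeight_pos _).ne' (Option.some_ne_none _)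
  · rw [indexWeight_inl, indexWeight_inr]
    exact iff_of_false (factorWeight_pos _).ne (Option.some_ne_none _).symm
  · exact iff_of_true rfl rfl

theorem block_eq_none_iff (x : Index d t) : Index.block d t x = none ↔ indexWeight d t x = 0 := by
  obtain x | a := x
  · exact iff_of_false (Option.some_ne_none _) (factorWeight_pos _).ne'
  · exact iff_of_true rfl rfl

theorem isSignedPower_indexWeight (x : Index d t) : IsSignedPower (indexWeight d t x) := by
  obtain x | a := x
  · exact isSignedPower_factorWeight _
  · exact isSignedPower_zero

theorem precedes_of_indexWeight_lt {x y : Index d t} (h : indexWeight d t y < indexWeight d t x) :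
    Index.precedes d t x y := by
  obtain x | a := x <;> obtain y | b := y
  · exact Sum.Lex.inl (Sigma.lex_iff.2 (Or.inl (factorWeight_lt_iff.1 h)))
  · exact Sum.Lex.sep _ _
  · exact absurd h (factorWeight_pos y.1).not_gt
  · exact absurd h (lt_irrefl 0)

theorem indexWeight_le_of_precedes {x y : Index d t} (h : Index.precedes d t x y) :
    indexWeight d t y ≤ indexWeight d t x := by
  obtain x | a := x <;> obtain y | b := y
  · rcases Sigma.lex_iff.1 (Sum.lex_inl_inl.1 h) with h | ⟨h, -⟩
    · exact (factorWeight_lt_iff.2 h).le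
    · rw [indexWeight_inl, indexWeight_inl, h]
  · exact (factorWeight_pos x.1).le
  · exact absurd h Sum.lex_inr_inl
  · exact le_rfl

theorem precedes_or_precedes {x y : Index d t} (h : x ≠ y) :
    Index.precedes d t x y ∨ Index.precedes d t y x := by
  obtain ⟨i, a⟩ | a := x <;> obtain ⟨j, b⟩ | b := y
  · rcases lt_trichotomy i j with hij | rfl | hij
    · exact Or.inl (Sum.Lex.inl (Sigma.Lex.left _ _ hij))
    · rcases lt_trichotomy a b with hab | rfl | hab
      · exact Or.inl (Sum.Lex.inl (Sigma.Lex.right _ _ hab))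
      · exact absurd rfl h
      · exact Or.inr (Sum.Lex.inl (Sigma.Lex.right _ _ hab))
    · exact Or.inr (Sum.Lex.inl (Sigma.Lex.left _ _ hij))
  · exact Or.inl (Sum.Lex.sep _ _)
  · exact Or.inr (Sum.Lex.sep _ _)
  · rcases lt_trichotomy a b with hab | rfl | hab
    · exact Or.inl (Sum.Lex.inr hab)
    · exact absurd rfl h
    · exact Or.inr (Sum.Lex.inr hab)

/-- The weight of a row of the matrices in types C and D. -/
def weightCD : Index d t ⊕ Index d t → ℝ := Sum.elim (indexWeight d t) fun x => -indexWeight d t x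

/-- The weight of a row of the matrices in type B. -/
def weightB : Unit ⊕ (Index d t ⊕ Index d t) → ℝ := Sum.elim (fun _ => 0) (weightCD d t)

/-- Weights separating the roots in types C and D. -/
def regularCD (I : Type) [Fintype I] : I ⊕ I → ℝ :=
  Sum.elim (fun x => 5 ^ (Fintype.equivFin I x : ℕ)) fun x => -5 ^ (Fintype.equivFin I x : ℕ)

/-- Weights separating the roots in type B. -/
def regularB (I : Type) [Fintype I] : Unit ⊕ (I ⊕ I) → ℝ := Sum.elim (fun _ => 0) (regularCD I)

theorem weightCD_eq_iff (p q : Index d t ⊕ Index d t) :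
    weightCD d t p = weightCD d t q ↔ blockCD d t p = blockCD d t q := by
  have key : ∀ x y : Index d t, indexWeight d t x = -indexWeight d t y ↔
      (Index.block d t x).map (fun i => (i, true)) =
        (Index.block d t y).map (fun i => (i, false)) := by
    intro x y
    have hx := indexWeight_nonneg d t x
    have hy := indexWeight_nonneg d t y
    constructor
    · intro h
      rw [(block_eq_none_iff d t x).2 (by linarith), (block_eq_none_iff d t y).2 (by linarith)]
      rfl
    · intro h
      cases hbx : Index.block d t x with
      | none =>
        rw [hbx] at h
        cases hby : Index.block d t y with
        | none =>
          rw [(block_eq_none_iff d t x).1 hbx, (block_eq_none_iff d t y).1 hby, neg_zero]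
        | some j => rw [hby] at h; simp at h
      | some i =>
        rw [hbx] at h
        cases hby : Index.block d t y <;> rw [hby] at h <;> simp at h
  have hinj : ∀ c : Bool, Function.Injective (Option.map fun i : Fin r => (i, c)) := fun c =>
    Option.map_injective fun i j h => congrArg Prod.fst h
  obtain x | x := p <;> obtain y | y := q
  · exact (indexWeight_eq_iff d t x y).trans (hinj true).eq_iff.symm
  · exact key x y
  · exact eq_comm.trans ((key y x).trans eq_comm)
  · exact neg_inj.trans ((indexWeight_eq_iff d t x y).trans (hinj false).eq_iff.symm)

theorem weightB_eq_iff (p q : Unit ⊕ (Index d t ⊕ Index d t)) :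
    weightB d t p = weightB d t q ↔ blockB d t p = blockB d t q := by
  have key : ∀ p, weightCD d t p = 0 ↔ blockCD d t p = none := by
    rintro (x | x)
    · exact (block_eq_none_iff d t x).symm.trans Option.map_eq_none_iff.symm
    · exact neg_eq_zero.trans ((block_eq_none_iff d t x).symm.trans Option.map_eq_none_iff.symm)
  obtain ⟨⟩ | p := p <;> obtain ⟨⟩ | q := q
  · exact iff_of_true rfl rfl
  · exact eq_comm.trans ((key q).trans eq_comm)
  · exact key p
  · exact weightCD_eq_iff d t p q

theorem weightCD_swap (p : Index d t ⊕ Index d t) : weightCD d t p.swap = -weightCD d t p := by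
  obtain x | x := p
  · rfl
  · exact (neg_neg _).symm

theorem isSignedPower_weightCD (p : Index d t ⊕ Index d t) : IsSignedPower (weightCD d t p) := by
  obtain x | x := p
  · exact isSignedPower_indexWeight d t x
  · exact (isSignedPower_indexWeight d t x).neg

theorem regularCD_swap {I : Type} [Fintype I] (p : I ⊕ I) :
    regularCD I p.swap = -regularCD I p := by
  obtain x | x := p
  · rfl
  · exact (neg_neg _).symm

theorem isSignedPower_regularCD {I : Type} [Fintype I] (p : I ⊕ I) :
    IsSignedPower (regularCD I p) := by
  obtain x | x := p
  · exact isSignedPower_pow _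
  · exact (isSignedPower_pow _).neg

theorem regularCD_ne_zero {I : Type} [Fintype I] (p : I ⊕ I) : regularCD I p ≠ 0 := by
  obtain x | x := p
  · exact pow_ne_zero _ (by norm_num)
  · exact neg_ne_zero.2 (pow_ne_zero _ (by norm_num))

theorem regularCD_injective {I : Type} [Fintype I] : Function.Injective (regularCD I) := by
  rintro (x | x) (y | y) h
  · exact congrArg Sum.inl (five_pow_injective h)
  · have h : (5 : ℝ) ^ (Fintype.equivFin I x : ℕ) = -5 ^ (Fintype.equivFin I y : ℕ) := h
    have h1 : (0 : ℝ) < 5 ^ (Fintype.equivFin I x : ℕ) := by positivity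
    have h2 : (0 : ℝ) < 5 ^ (Fintype.equivFin I y : ℕ) := by positivity
    linarith
  · have h : -(5 : ℝ) ^ (Fintype.equivFin I x : ℕ) = 5 ^ (Fintype.equivFin I y : ℕ) := h
    have h1 : (0 : ℝ) < 5 ^ (Fintype.equivFin I x : ℕ) := by positivity
    have h2 : (0 : ℝ) < 5 ^ (Fintype.equivFin I y : ℕ) := by positivity
    linarith
  · exact congrArg Sum.inr (five_pow_injective (neg_inj.1 h))

theorem regularB_injective {I : Type} [Fintype I] : Function.Injective (regularB I) := by
  rintro (⟨⟩ | p) (⟨⟩ | q) h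
  · rfl
  · exact absurd h.symm (regularCD_ne_zero q)
  · exact absurd h (regularCD_ne_zero p)
  · exact congrArg Sum.inr (regularCD_injective h)

/-- The shape of the difference of two coordinates `c p - c q` for `p` of larger weight than `q`. -/
theorem sub_eq_of_weightCD_lt {V : Type*} [AddCommGroup V] {c : Index d t ⊕ Index d t → V}
    (hc : ∀ x, c (Sum.inr x) = -c (Sum.inl x)) {p q : Index d t ⊕ Index d t}
    (h : weightCD d t q < weightCD d t p) :
    (∃ x y, Index.precedes d t x y ∧ (c p - c q = c (Sum.inl x) - c (Sum.inl y) ∨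
      c p - c q = c (Sum.inl x) + c (Sum.inl y))) ∨
    (q = p.swap ∧ ∃ x, c p - c q = c (Sum.inl x) + c (Sum.inl x)) := by
  obtain x | x := p <;> obtain y | y := q
  · exact Or.inl ⟨x, y, precedes_of_indexWeight_lt d t h, Or.inl rfl⟩
  · rw [hc, sub_neg_eq_add]
    by_cases hxy : x = y
    · subst hxy
      exact Or.inr ⟨rfl, x, rfl⟩
    · rcases precedes_or_precedes d t hxy with h | h
      · exact Or.inl ⟨x, y, h, Or.inr rfl⟩
      · exact Or.inl ⟨y, x, h, Or.inr (add_comm _ _)⟩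
  · have h : indexWeight d t y < -indexWeight d t x := h
    have := indexWeight_nonneg d t x
    have := indexWeight_nonneg d t y
    linarith
  · have h : -indexWeight d t y < -indexWeight d t x := h
    refine Or.inl ⟨y, x, precedes_of_indexWeight_lt d t (neg_lt_neg_iff.1 h), Or.inl ?_⟩
    rw [hc, hc]
    abel

end CoordinateWeights

/-! ### Types B, C, D -/

section Instances

/-- The form has one nonzero entry in each row and column, so Xᵀ J = -J X compares single entries of
X. -/
theorem mem_skewAdjointMatricesLieSubalgebra_iff_of_paired {N : Type} [Fintype N] [DecidableEq N]
    {J : Matrix N N ℂ} {σ : N → N} {s : N → ℂ} (hσ : ∀ p, σ (σ p) = p)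
    (hs : ∀ p, s p = 1 ∨ s p = -1) (hJ : ∀ p q, J p q = if q = σ p then s p else 0)
    (X : Matrix N N ℂ) :
    X ∈ skewAdjointMatricesLieSubalgebra J ↔ ∀ p q, X (σ q) (σ p) = -(s p * s q) * X p q := by
  have hs2 : ∀ p, s p * s p = 1 := fun p => by rcases hs p with h | h <;> rw [h] <;> norm_num
  have h1 : ∀ p q, (X.transpose * J) p q = X (σ q) p * s (σ q) := by
    intro p q
    rw [Matrix.mul_apply, Finset.sum_eq_single (σ q), hJ, hσ, if_pos rfl, Matrix.transpose_apply]
    · intro l _ hl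
      rw [hJ, if_neg fun h => hl (by rw [h, hσ]), mul_zero]
    · simp
  have h2 : ∀ p q, (J * -X) p q = -(s p * X (σ p) q) := by
    intro p q
    rw [Matrix.mul_apply, Finset.sum_eq_single (σ p), hJ, if_pos rfl, Matrix.neg_apply, mul_neg]
    · intro l _ hl
      rw [hJ, if_neg hl, zero_mul]
    · simp
  rw [mem_skewAdjointMatricesLieSubalgebra, mem_skewAdjointMatricesSubmodule]
  change X.transpose * J = J * -X ↔ _
  rw [← Matrix.ext_iff]
  simp only [h1, h2]
  constructor
  · intro h p q
    have e := h q (σ p)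
    rw [hσ] at e
    have h4 := hs2 q
    linear_combination s q * e - X (σ q) (σ p) * h4
  · intro h p q
    have e := h (σ q) p
    rw [hσ] at e
    have h3 := hs2 p
    linear_combination s p * e - X (σ q) p * s (σ q) * h3

variable {r : ℕ} (d : Fin r → ℕ) (t : ℕ)

theorem isPairedFrame_of_swap {g : LieSubalgebra ℂ (Matrix (Index d t ⊕ Index d t) _ ℂ)}
    {s : Index d t ⊕ Index d t → ℂ} {ε : ℂ} (hε : ε = 1 ∨ ε = -1) (hs : ∀ p, s p = 1 ∨ s p = -1)
    (hsε : ∀ p, s p.swap = ε * s p)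
    (hg : ∀ X, X ∈ g ↔ ∀ p q, X (Sum.swap q) (Sum.swap p) = -(s p * s q) * X p q)
    (h1 : ε = 1 → ∀ x : Index d t, ∃ y, y ≠ x) (h2 : ε = 1 → ∀ a : Fin t, ∃ b, b ≠ a) :
    IsPairedFrame g (blockCD d t) Sum.swap s ε (weightCD d t) (regularCD (Index d t)) where
  pair_pair := Sum.swap_swap
  symm_eq := hε
  sign_eq := hs
  sign_pair := hsε
  mem_iff := hg
  wt_eq_iff := weightCD_eq_iff d t
  wt_pair := weightCD_swap d t
  wt_isSignedPower := isSignedPower_weightCD d t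
  reg_pair := regularCD_swap
  reg_isSignedPower := isSignedPower_regularCD
  reg_injective := regularCD_injective
  exists_third := by
    rintro (x | x) hε -
    · obtain ⟨y, hy⟩ := h1 hε x
      exact ⟨Sum.inl y, by simpa using hy, Sum.inl_ne_inr⟩
    · obtain ⟨y, hy⟩ := h1 hε x
      exact ⟨Sum.inr y, by simpa using hy, Sum.inr_ne_inl⟩
  exists_third_of_wt_eq_zero := by
    rintro ((x | a) | (x | a)) hε - h
    · exact absurd h (factorWeight_pos _).ne'
    · obtain ⟨b, hb⟩ := h2 hε a
      exact ⟨Sum.inl (Sum.inr b), rfl, by simpa using hb, Sum.inl_ne_inr⟩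
    · exact absurd (neg_eq_zero.1 h) (factorWeight_pos _).ne'
    · obtain ⟨b, hb⟩ := h2 hε a
      exact ⟨Sum.inr (Sum.inr b), neg_zero, by simpa using hb, Sum.inr_ne_inl⟩

/-- The signs are those of `Matrix.J`: -1 in the upper right block and 1 in the lower left. -/
theorem isPairedFrameC : IsPairedFrame (gC d t) (blockCD d t) Sum.swap
    (Sum.elim (fun _ => -1) fun _ => 1) (-1) (weightCD d t) (regularCD (Index d t)) := by
  have hs : ∀ p : Index d t ⊕ Index d t, Sum.elim (fun _ => (-1 : ℂ)) (fun _ => 1) p = 1 ∨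
      Sum.elim (fun _ => (-1 : ℂ)) (fun _ => 1) p = -1 := by
    rintro (x | x)
    · exact Or.inr rfl
    · exact Or.inl rfl
  have hε : (-1 : ℂ) ≠ 1 := by norm_num
  refine isPairedFrame_of_swap d t (Or.inr rfl) hs ?_ ?_ (fun h => absurd h hε)
    (fun h => absurd h hε)
  · rintro (x | x) <;> simp
  · refine mem_skewAdjointMatricesLieSubalgebra_iff_of_paired Sum.swap_swap hs ?_
    rintro (x | x) (y | y) <;> simp [Matrix.J, Matrix.one_apply, eq_comm, apply_ite]

/-- The hypotheses say that neither the rank n nor t is 1; they supply the third rows. -/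
theorem isPairedFrameD (h1 : ∀ x : Index d t, ∃ y, y ≠ x) (h2 : ∀ a : Fin t, ∃ b, b ≠ a) :
    IsPairedFrame (gD d t) (blockCD d t) Sum.swap (fun _ => 1) 1 (weightCD d t)
      (regularCD (Index d t)) := by
  refine isPairedFrame_of_swap d t (Or.inl rfl) (fun _ => Or.inl rfl) (fun _ => by norm_num) ?_
    (fun _ => h1) (fun _ => h2)
  refine mem_skewAdjointMatricesLieSubalgebra_iff_of_paired Sum.swap_swap (fun _ => Or.inl rfl) ?_
  rintro (x | x) (y | y) <;> simp [LieAlgebra.Orthogonal.JD, Matrix.one_apply, eq_comm]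

/-- The extra row is fixed by the pairing and has weight 0, so it serves as the third row without
any bound on the ranks. -/
theorem isPairedFrameB : IsPairedFrame (gB d t) (blockB d t) (Sum.map id Sum.swap) (fun _ => 1) 1
    (weightB d t) (regularB (Index d t)) where
  pair_pair := by rintro (⟨⟩ | x | x) <;> rfl
  symm_eq := Or.inl rfl
  sign_eq := fun _ => Or.inl rfl
  sign_pair := fun _ => by norm_num
  mem_iff := by
    refine mem_skewAdjointMatricesLieSubalgebra_iff_of_paired (by rintro (⟨⟩ | x | x) <;> rfl)
      (fun _ => Or.inl rfl) ?_
    rintro (⟨⟩ | x | x) (⟨⟩ | y | y) <;>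
      simp [formB, LieAlgebra.Orthogonal.JD, Matrix.one_apply, eq_comm]
  wt_eq_iff := weightB_eq_iff d t
  wt_pair := by
    rintro (⟨⟩ | p)
    · exact neg_zero.symm
    · exact weightCD_swap d t p
  wt_isSignedPower := by
    rintro (⟨⟩ | p)
    · exact isSignedPower_zero
    · exact isSignedPower_weightCD d t p
  reg_pair := by
    rintro (⟨⟩ | p)
    · exact neg_zero.symm
    · exact regularCD_swap p
  reg_isSignedPower := by
    rintro (⟨⟩ | p)
    · exact isSignedPower_zero
    · exact isSignedPower_regularCD p
  reg_injective := regularB_injective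
  exists_third := by
    rintro (⟨⟩ | p) - h
    · exact absurd rfl h
    · exact ⟨Sum.inl (), Sum.inl_ne_inr, Sum.inl_ne_inr⟩
  exists_third_of_wt_eq_zero := by
    rintro (⟨⟩ | p) - h -
    · exact absurd rfl h
    · exact ⟨Sum.inl (), rfl, Sum.inl_ne_inr, Sum.inl_ne_inr⟩

theorem encard_positiveWeightsCD {g : LieSubalgebra ℂ (Matrix (Index d t ⊕ Index d t) _ ℂ)}
    {s : Index d t ⊕ Index d t → ℂ} {ε : ℂ} (hd : ∀ i, 1 ≤ d i)
    (hg : IsPairedFrame g (blockCD d t) Sum.swap s ε (weightCD d t) (regularCD (Index d t)))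
    {c : ℕ} (hc : ∀ S : Finset (Fin r), (∀ i, i ∈ S ↔ ε = -1 ∨ 1 < d i) → S.card = c) :
    (positiveWeights g (weightCD d t)).encard =
      ((r * (r - 1) + c + if t = 0 then 0 else r : ℕ) : ℕ∞) := by
  classical
  rw [hg.encard_positiveWeights hd (fun x => Sum.inl (Sum.inl x))
    (Sum.inl_injective.comp Sum.inl_injective) (fun _ => rfl) ?_, hc _ (by simp)]
  · have hiff : (∃ p, weightCD d t p = 0) ↔ t ≠ 0 := by
      constructor
      · rintro ⟨(x | a) | (x | a), h⟩
        · exact absurd h (factorWeight_pos _).ne'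
        · have := a.pos
          omega
        · exact absurd (neg_eq_zero.1 h) (factorWeight_pos _).ne'
        · have := a.pos
          omega
      · intro h
        exact ⟨Sum.inl (Sum.inr ⟨0, Nat.pos_of_ne_zero h⟩), rfl⟩
    congr 2
    by_cases h : t = 0
    · rw [if_neg (by simpa [hiff] using h), if_pos h]
    · rw [if_pos (hiff.2 h), if_neg h]
  · rintro ((x | a) | (x | a))
    · exact Or.inl ⟨x, rfl⟩
    · exact Or.inr (Or.inr rfl)
    · exact Or.inr (Or.inl ⟨x, rfl⟩)
    · exact Or.inr (Or.inr neg_zero)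

theorem encard_positiveWeightsB (hd : ∀ i, 1 ≤ d i) :
    (positiveWeights (gB d t) (weightB d t)).encard =
      ((r * (r - 1) + (Finset.univ.filter fun i => 1 < d i).card + r : ℕ) : ℕ∞) := by
  classical
  have hε : ¬ (1 : ℂ) = -1 := by norm_num
  rw [(isPairedFrameB d t).encard_positiveWeights hd (fun x => Sum.inr (Sum.inl (Sum.inl x)))
    (Sum.inr_injective.comp (Sum.inl_injective.comp Sum.inl_injective)) (fun _ => rfl) ?_,
    if_pos ⟨Sum.inl (), rfl⟩]
  · congr 4
    ext i
    simp [hε]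
  · rintro (⟨⟩ | (x | a) | (x | a))
    · exact Or.inr (Or.inr rfl)
    · exact Or.inl ⟨x, rfl⟩
    · exact Or.inr (Or.inr rfl)
    · exact Or.inr (Or.inl ⟨x, rfl⟩)
    · exact Or.inr (Or.inr neg_zero)

theorem summandCountC (hd : ∀ i, 1 ≤ d i) :
    SummandCount (gC d t) (blockCD d t) (posC d t) (r * (r - 1) + r + if t = 0 then 0 else r) := by
  have hg := isPairedFrameC d t
  have hc : ∀ x, coord (gC d t) (Sum.inr x) = -coord (gC d t) (Sum.inl x) := fun x =>
    hg.coord_pair (Sum.inl x)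
  refine hg.summandCount ?_ ?_ (encard_positiveWeightsCD d t hd hg fun S hS => ?_)
  · intro p q _ h
    rcases sub_eq_of_weightCD_lt d t hc h with ⟨x, y, hxy, h⟩ | ⟨-, x, h⟩
    · exact Or.inr ⟨x, y, hxy, h⟩
    · exact Or.inl ⟨x, h.trans (two_smul ℂ _).symm⟩
  · rintro α (⟨x, rfl⟩ | ⟨x, y, hxy, rfl | rfl⟩)
    · refine ⟨Sum.inl x, Sum.inr x, ?_, ?_⟩
      · have := indexWeight_nonneg d t x
        exact (neg_nonpos.2 this).trans this
      · rw [hc, sub_neg_eq_add, two_smul]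
        rfl
    · exact ⟨Sum.inl x, Sum.inl y, indexWeight_le_of_precedes d t hxy, rfl⟩
    · refine ⟨Sum.inl x, Sum.inr y, ?_, ?_⟩
      · exact (neg_nonpos.2 (indexWeight_nonneg d t y)).trans (indexWeight_nonneg d t x)
      · rw [hc, sub_neg_eq_add]
        rfl
  · rw [Finset.eq_univ_iff_forall.2 fun i => (hS i).2 (Or.inl rfl), Finset.card_univ,
      Fintype.card_fin]

theorem summandCountD (hd : ∀ i, 1 ≤ d i) (h1 : ∀ x : Index d t, ∃ y, y ≠ x)
    (h2 : ∀ a : Fin t, ∃ b, b ≠ a) :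
    SummandCount (gD d t) (blockCD d t) (posD d t)
      (r * (r - 1) + (Finset.univ.filter fun i => 1 < d i).card + if t = 0 then 0 else r) := by
  have hg := isPairedFrameD d t h1 h2
  have hε : ¬ (1 : ℂ) = -1 := by norm_num
  have hc : ∀ x, coord (gD d t) (Sum.inr x) = -coord (gD d t) (Sum.inl x) := fun x =>
    hg.coord_pair (Sum.inl x)
  refine hg.summandCount ?_ ?_ (encard_positiveWeightsCD d t hd hg fun S hS => ?_)
  · intro p q hpq h
    rcases sub_eq_of_weightCD_lt d t hc h with ⟨x, y, hxy, h⟩ | ⟨h, -⟩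
    · exact ⟨x, y, hxy, h⟩
    · exact absurd h (hpq.resolve_left hε)
  · rintro α ⟨x, y, hxy, rfl | rfl⟩
    · exact ⟨Sum.inl x, Sum.inl y, indexWeight_le_of_precedes d t hxy, rfl⟩
    · refine ⟨Sum.inl x, Sum.inr y, ?_, ?_⟩
      · exact (neg_nonpos.2 (indexWeight_nonneg d t y)).trans (indexWeight_nonneg d t x)
      · rw [hc, sub_neg_eq_add]
        rfl
  · congr 1
    ext i
    rw [hS, Finset.mem_filter, or_iff_right hε]
    simp

theorem summandCountB (hd : ∀ i, 1 ≤ d i) :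
    SummandCount (gB d t) (blockB d t) (posB d t)
      (r * (r - 1) + (Finset.univ.filter fun i => 1 < d i).card + r) := by
  have hg := isPairedFrameB d t
  have hε : ¬ (1 : ℂ) = -1 := by norm_num
  have hc : ∀ x, coord (gB d t) (Sum.inr (Sum.inr x)) = -coord (gB d t) (Sum.inr (Sum.inl x)) :=
    fun x => hg.coord_pair (Sum.inr (Sum.inl x))
  -- The extra row is its own partner, so its coordinate equals its negative.
  have hc0 : coord (gB d t) (Sum.inl ()) = 0 := LinearMap.ext fun H =>
    self_eq_neg.1 (LinearMap.congr_fun (hg.coord_pair (Sum.inl ())) H)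
  refine hg.summandCount ?_ ?_ (encard_positiveWeightsB d t hd)
  · rintro (⟨⟩ | p) (⟨⟩ | q) hpq h
    · exact absurd h (lt_irrefl 0)
    · have h : weightCD d t q < 0 := h
      obtain x | x := q
      · exact absurd h (indexWeight_nonneg d t x).not_gt
      · exact Or.inl ⟨x, by rw [hc, hc0, sub_neg_eq_add, zero_add]; rfl⟩
    · have h : 0 < weightCD d t p := h
      obtain x | x := p
      · exact Or.inl ⟨x, by rw [hc0, sub_zero]; rfl⟩
      · exact absurd h (neg_nonpos.2 (indexWeight_nonneg d t x)).not_gt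
    · rcases sub_eq_of_weightCD_lt d t (c := fun p => coord (gB d t) (Sum.inr p)) hc h with
        ⟨x, y, hxy, h⟩ | ⟨h, -⟩
      · exact Or.inr ⟨x, y, hxy, h⟩
      · exact absurd (congrArg Sum.inr h) (hpq.resolve_left hε)
  · rintro α (⟨x, rfl⟩ | ⟨x, y, hxy, rfl | rfl⟩)
    · refine ⟨Sum.inr (Sum.inl x), Sum.inl (), indexWeight_nonneg d t x, ?_⟩
      rw [hc0, sub_zero]
      rfl
    · exact ⟨Sum.inr (Sum.inl x), Sum.inr (Sum.inl y), indexWeight_le_of_precedes d t hxy, rfl⟩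
    · refine ⟨Sum.inr (Sum.inl x), Sum.inr (Sum.inr y), ?_, ?_⟩
      · exact (neg_nonpos.2 (indexWeight_nonneg d t y)).trans (indexWeight_nonneg d t x)
      · rw [hc, sub_neg_eq_add]
        rfl

end Instances

end FlagManifold

end

/-! ### The seven families. -/

theorem mainTheorem1 {r : ℕ} (d : Fin r → ℕ) (hd : ∀ i, 1 ≤ d i) (s m : ℕ)
    (hs : s = (Finset.univ.filter (fun i => 1 < d i)).card)
    (hm : m = (Finset.univ.filter (fun i => d i = 1)).card) :
    -- type A
    FlagManifold.SummandCount (FlagManifold.gA d) (FlagManifold.blockA d) (FlagManifold.posA d)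
      (r * (r - 1) / 2) ∧
    -- type B (i)
    (2 ≤ ∑ i, d i →
      FlagManifold.SummandCount (FlagManifold.gB d 0) (FlagManifold.blockB d 0)
        (FlagManifold.posB d 0) ((s + m) ^ 2 + s)) ∧
    -- type B (ii)
    (∀ t : ℕ, 2 ≤ t →
      FlagManifold.SummandCount (FlagManifold.gB d t) (FlagManifold.blockB d t)
        (FlagManifold.posB d t) ((s + m) ^ 2 + s)) ∧
    -- type C (i)
    (3 ≤ ∑ i, d i →
      FlagManifold.SummandCount (FlagManifold.gC d 0) (FlagManifold.blockCD d 0)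
        (FlagManifold.posC d 0) ((s + m) ^ 2)) ∧
    -- type C (ii)
    (∀ t : ℕ, 3 ≤ t →
      FlagManifold.SummandCount (FlagManifold.gC d t) (FlagManifold.blockCD d t)
        (FlagManifold.posC d t) ((s + m) ^ 2 + (s + m))) ∧
    -- type D (i)
    (4 ≤ ∑ i, d i →
      FlagManifold.SummandCount (FlagManifold.gD d 0) (FlagManifold.blockCD d 0)
        (FlagManifold.posD d 0) ((s + m) ^ 2 - m)) ∧
    -- type D (ii)
    (∀ t : ℕ, 4 ≤ t →
      FlagManifold.SummandCount (FlagManifold.gD d t) (FlagManifold.blockCD d t)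
        (FlagManifold.posD d t) ((s + m) ^ 2 + s)) := by
  have hr : r = s + m := by
    have h := Finset.card_filter_add_card_filter_not (s := (Finset.univ : Finset (Fin r)))
      (fun i => 1 < d i)
    rw [Finset.card_univ, Fintype.card_fin, ← hs] at h
    rw [← h, hm]
    congr 2
    ext i
    have := hd i
    simp only [Finset.mem_filter, Finset.mem_univ, true_and]
    omega
  -- All counts have the form r(r-1) + ⋯; with r = s + m this turns r(r-1) + s into (s+m)² - m for
  -- type D (i).
  have hsq : r * (r - 1) + r = (s + m) ^ 2 := by
    rw [← hr]
    cases r with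
    | zero => rfl
    | succ n => rw [Nat.add_sub_cancel]; ring
  have hB : ∀ t, FlagManifold.SummandCount (FlagManifold.gB d t) (FlagManifold.blockB d t)
      (FlagManifold.posB d t) ((s + m) ^ 2 + s) := fun t => by
    convert FlagManifold.summandCountB d t hd using 1
    omega
  refine ⟨FlagManifold.summandCountA d hd, fun _ => hB 0, fun t _ => hB t, fun _ => ?_,
    fun t ht => ?_, fun hn => ?_, fun t ht => ?_⟩
  · convert FlagManifold.summandCountC d 0 hd using 1
    rw [if_pos rfl, hsq, add_zero]
  · convert FlagManifold.summandCountC d t hd using 1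
    rw [if_neg (by omega), hsq, hr]
  · convert FlagManifold.summandCountD d 0 hd ?_ (fun a => a.elim0) using 1
    · rw [if_pos rfl]
      omega
    -- The bound on n is needed here only to have a second coordinate.
    · have : Nontrivial (FlagManifold.Index d 0) := by
        rw [← Fintype.one_lt_card_iff_nontrivial]
        simp
        omega
      exact fun x => exists_ne x
  · have : Nontrivial (Fin t) := Fin.nontrivial_iff_two_le.2 (by omega)
    convert FlagManifold.summandCountD d t hd (fun x => ?_) (fun a => exists_ne a) using 1
    · rw [if_neg (by omega)]
      omega
    · have : Nontrivial (FlagManifold.Index d t) := Sum.inr_injective.nontrivial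
      exact exists_ne x
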